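/- Let $p$ be a prime, let $\mathbf a_1,\dots,\mathbf a_N\in\mathbb Z^n$ be distinct, let $v_1,\dots,v_N$ be independent variables and $f(\mathbf x)=\sum_{i=1}^N v_i\mathbf x^{\mathbf a_i}$. Let $\Delta\subset\mathbb R^n$ be the convex hull of $\mathbf a_1,\dots,\mathbf a_N$. Let $\mu\subseteq\Delta$ be open, that is, $\Delta\setminus\mu$ is a union of faces of $\Delta$ of any dimensions. Put $h=\#(\mu\cap\mathbb Z^n)$ and assume that $h\ge 1$ and $\#\{j:\mathbf a_j\in\mu\}=h$. For $1\le i\le N$ let $L_i$ be the set of $\ell\in\mathbb Z^N$ with $\sum_r\ell_r(1,\mathbf a_r)=\mathbf 0$ and $\ell_r\ge 0$ for all $r\ne i$. Let $L^\circ(\mathbb R)$ be the sum of the real cones generated by $L_1,\dots,L_N$, let $L^\circ=L^\circ(\mathbb R)\cap\mathbb Z^N$, and let $\mathcal R=\{\sum_{\ell\in L^\circ}b_\ell\mathbf v^\ell : b_\ell\in\mathbb Z\}$ be the ring of formal series supported in $L^\circ$. For $\mathbf a_i,\mathbf a_j\in\mu$ let $$\tilde\Psi_{ji}=v_j\cdot\text{constant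 term in }\mathbf x\text{ of }\ \frac{\mathbf x^{\mathbf a_j-\mathbf a_i}}{v_i}\sum_{k\ge 0}(-1)^k\Bigl(\sum_{r\ne i}\frac{v_r}{v_i}\mathbf x^{\mathbf a_r-\mathbf a_i}\Bigr)^k$$ (the renormalised constant term of the Laurent series expansion of $\mathbf x^{\mathbf a_j}/f(\mathbf x)$ with respect to $\mathbf a_i$) and, for $m\ge 1$, $$(\tilde\psi_m)_{ji}=v_j\cdot\text{constant term in }\mathbf x\text{ of }\ \Bigl(1-\Bigl(1-\frac{f(\mathbf x)}{v_i\mathbf x^{\mathbf a_i}}\Bigr)^m\Bigr)\frac{\mathbf x^{\mathbf a_j}}{f(\mathbf x)} ,$$ which amounts to keeping only the terms with $0\le k\le m-1$ in the sum above. These are elements of $\mathcal R$ and form $h\times h$ matrices $\tilde\Psi$ and $\tilde\psi_m$. Then $\tilde\Psi$ and all $\tilde\psi_m$ with $m\ge 1$ are invertible over $\mathcal R$. Let $\sigma:\mathcal R\to\mathcal R$ be the Frobenius lift with $v_j\mapsto v_j^p$ for all $j$, and let $\delta$ be any of the derivations $v_s\,\partial/\partial v_s$ of $\mathcal R$, $1\le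 s\le N$. Then for all $m\ge 1$ $$\tilde\Psi\cdot\sigma(\tilde\Psi)^{-1}\equiv\tilde\psi_m\cdot\sigma(\tilde\psi_{m/p})^{-1}\pmod{p^{\mathrm{ord}_p(m)}}$$ and $$\delta(\tilde\Psi)\cdot\tilde\Psi^{-1}\equiv\delta(\tilde\psi_m)\cdot\tilde\psi_m^{-1}\pmod{p^{\mathrm{ord}_p(m)}},$$ the congruences being entrywise in $\mathcal R$ (they are void when $p\nmid m$). -/

import Mathlib

open scoped BigOperators

noncomputable section

namespace AHypergeometric

/-! ### Relations between the exponents and the cone spanned by them -/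

/-- The vector `(1, u)` obtained from `u` by putting an extra component `1` in front. -/
def homog {n : ℕ} (u : Fin n → ℤ) : Fin (n + 1) → ℤ := Fin.cons 1 u

/-- `L_i`: the integral relations `∑ r, l r • (1, a r) = 0` with `l r ≥ 0` for all `r ≠ i`. -/
def relations {N n : ℕ} (a : Fin N ↪ (Fin n → ℤ)) (i : Fin N) : Set (Fin N → ℤ) :=
  {l | ∑ r, l r • homog (a r) = 0 ∧ ∀ r, r ≠ i → 0 ≤ l r}

/-- An integral vector regarded as a real vector. -/
def toReal {k : ℕ} (u : Fin k → ℤ) : Fin k → ℝ := fun r => (u r : ℝ)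

/-- `L°(ℝ)`: the sum over `i` of the real cones generated by the `L_i`. -/
def realCone {N n : ℕ} (a : Fin N ↪ (Fin n → ℤ)) : PointedCone ℝ (Fin N → ℝ) :=
  ⨆ i, PointedCone.hull ℝ (toReal '' relations a i)

/-- `L° = L°(ℝ) ∩ ℤ^N`. -/
def latticeCone {N n : ℕ} (a : Fin N ↪ (Fin n → ℤ)) : AddSubmonoid (Fin N → ℤ) where
  carrier := {l | toReal l ∈ realCone a}
  zero_mem' := by
    have : toReal (0 : Fin N → ℤ) = 0 := by ext; simp [toReal]
    simp [this]
  add_mem' := by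
    intro x y hx hy
    have : toReal (x + y) = toReal x + toReal y := by ext; simp [toReal]
    simp only [Set.mem_ofPred_eq] at *
    rw [this]
    exact add_mem hx hy

theorem relations_subset_latticeCone {N n : ℕ} (a : Fin N ↪ (Fin n → ℤ)) (i : Fin N) :
    relations a i ⊆ latticeCone a := fun l hl =>
  (le_iSup (fun i => PointedCone.hull ℝ (toReal '' relations a i)) i)
    (Submodule.subset_span ⟨l, hl, rfl⟩)

/-- A linear form which is positive on the nonzero elements of `L°(ℝ)`. It is used only to show
that elements of `L°` have finitely many decompositions as a sum of two elements of `L°`. -/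
def weight {N n : ℕ} (a : Fin N ↪ (Fin n → ℤ)) (x : Fin N → ℝ) : ℝ :=
  ∑ r, x r * ∑ d, (a r d : ℝ) ^ 2

theorem abs_le_weight_of_relation {N n : ℕ} (a : Fin N ↪ (Fin n → ℤ)) (i : Fin N)
    (l : Fin N → ℤ) (hl : l ∈ relations a i) (r : Fin N) : |toReal l r| ≤ weight a (toReal l) := by
  obtain ⟨hs, hp⟩ := hl
  have h0 : ∑ r, l r = 0 := by
    have := congrFun hs 0
    simpa [homog, Finset.sum_apply] using this
  have h1 : ∀ d, ∑ r, l r * a r d = 0 := by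
    intro d
    have := congrFun hs d.succ
    simpa [homog, Finset.sum_apply] using this
  have hw : weight a (toReal l) = ((∑ r, l r * ∑ d, (a r d - a i d) ^ 2 : ℤ) : ℝ) := by
    have : (∑ r, l r * ∑ d, (a r d - a i d) ^ 2 : ℤ) = ∑ r, l r * ∑ d, (a r d) ^ 2 := by
      have e : ∀ r, l r * ∑ d, (a r d - a i d) ^ 2 = l r * (∑ d, (a r d) ^ 2)
          - 2 * ∑ d, a i d * (l r * a r d) + l r * ∑ d, (a i d) ^ 2 := by
        intro r
        simp only [Finset.mul_sum, ← Finset.sum_sub_distrib, ← Finset.sum_add_distrib]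
        exact Finset.sum_congr rfl fun d _ => by ring
      simp only [e, Finset.sum_add_distrib, Finset.sum_sub_distrib, ← Finset.mul_sum,
        ← Finset.sum_mul, h0]
      rw [Finset.sum_comm]
      simp only [← Finset.mul_sum, h1]
      simp
    rw [this]
    simp [weight, toReal]
  have hd : ∀ r, r ≠ i → 1 ≤ ∑ d, (a r d - a i d) ^ 2 := by
    intro r hr
    obtain ⟨d, hd⟩ : ∃ d, a r d ≠ a i d := by
      by_contra hc
      push Not at hc
      exact hr (a.injective (funext hc))
    have : (a r d - a i d) ^ 2 ≤ ∑ d, (a r d - a i d) ^ 2 :=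
      Finset.single_le_sum (f := fun d => (a r d - a i d) ^ 2) (fun _ _ => sq_nonneg _)
        (Finset.mem_univ d)
    have h2 : 0 < (a r d - a i d) ^ 2 := by
      have := sub_ne_zero.mpr hd
      positivity
    omega
  have hle : ∑ r ∈ Finset.univ.erase i, l r ≤ ∑ r, l r * ∑ d, (a r d - a i d) ^ 2 := by
    rw [← Finset.add_sum_erase Finset.univ _ (Finset.mem_univ i)]
    simp only [sub_self, ne_eq, OfNat.ofNat_ne_zero, not_false_eq_true, zero_pow,
      Finset.sum_const_zero, mul_zero, zero_add]
    refine Finset.sum_le_sum fun r hr => ?_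
    have hr := Finset.ne_of_mem_erase hr
    nlinarith [hp r hr, hd r hr]
  have hi : l i = -∑ r ∈ Finset.univ.erase i, l r := by
    rw [← Finset.add_sum_erase Finset.univ _ (Finset.mem_univ i)] at h0
    omega
  have hpos : 0 ≤ ∑ r ∈ Finset.univ.erase i, l r :=
    Finset.sum_nonneg fun r hr => hp r (Finset.ne_of_mem_erase hr)
  have key : |l r| ≤ ∑ r ∈ Finset.univ.erase i, l r := by
    by_cases hr : r = i
    · rw [hr, hi, abs_neg, abs_of_nonneg hpos]
    · rw [abs_of_nonneg (hp r hr)]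
      exact Finset.single_le_sum (f := l) (fun r hr => hp r (Finset.ne_of_mem_erase hr))
        (Finset.mem_erase.mpr ⟨hr, Finset.mem_univ r⟩)
  rw [hw]
  simp only [toReal]
  exact_mod_cast key.trans hle

theorem abs_le_weight {N n : ℕ} (a : Fin N ↪ (Fin n → ℤ)) {x : Fin N → ℝ} (hx : x ∈ realCone a)
    (r : Fin N) : |x r| ≤ weight a x := by
  let B : PointedCone ℝ (Fin N → ℝ) :=
    { carrier := {x | ∀ r, |x r| ≤ weight a x}
      zero_mem' := by intro r; simp [weight]
      add_mem' := by
        intro x y hx hy r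
        have : weight a (x + y) = weight a x + weight a y := by
          simp [weight, add_mul, Finset.sum_add_distrib]
        rw [this]
        exact (abs_add_le _ _).trans (add_le_add (hx r) (hy r))
      smul_mem' := by
        rintro ⟨c, hc⟩ x hx r
        have : weight a ((⟨c, hc⟩ : {c : ℝ // 0 ≤ c}) • x) = c * weight a x := by
          simp [weight, Finset.mul_sum, mul_assoc, Nonneg.mk_smul]
        rw [this]
        simp only [Nonneg.mk_smul, Pi.smul_apply, smul_eq_mul, abs_mul, abs_of_nonneg hc]
        exact mul_le_mul_of_nonneg_left (hx r) hc }
  have hB : realCone a ≤ B := by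
    refine iSup_le fun i => Submodule.span_le.mpr ?_
    rintro _ ⟨l, hl, rfl⟩ r
    exact abs_le_weight_of_relation a i l hl r
  exact hB hx r

theorem finite_decompositions {N n : ℕ} (a : Fin N ↪ (Fin n → ℤ)) (k : latticeCone a) :
    {x : latticeCone a × latticeCone a | x.1 + x.2 = k}.Finite := by
  obtain ⟨B, hB⟩ : ∃ B : ℕ, weight a (toReal k.1) ≤ B := exists_nat_ge _
  let box : Set (Fin N → ℤ) := Set.Icc (fun _ => -(B : ℤ)) (fun _ => (B : ℤ))
  have hbox : (box ×ˢ box).Finite := (Set.finite_Icc _ _).prod (Set.finite_Icc _ _)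
  refine Set.Finite.of_finite_image (f := fun x => (x.1.1, x.2.1)) (hbox.subset ?_) ?_
  · rintro _ ⟨⟨x, y⟩, hxy, rfl⟩
    have hw : weight a (toReal k.1) = weight a (toReal x.1) + weight a (toReal y.1) := by
      have : k.1 = x.1 + y.1 := by rw [← (show x + y = k from hxy)]; rfl
      rw [this]
      simp [weight, toReal, add_mul, Finset.sum_add_distrib]
    have hx := abs_le_weight a x.2
    have hy := abs_le_weight a y.2
    have hb : ∀ (u v : latticeCone a) (r : Fin N),
        weight a (toReal u.1) + weight a (toReal v.1) ≤ B → |u.1 r| ≤ (B : ℤ) := by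
      intro u v r h
      have h1 := abs_le_weight a u.2 r
      have h2 := (abs_nonneg _).trans (abs_le_weight a v.2 r)
      have : (|toReal u.1 r|) ≤ (B : ℝ) := by linarith
      simp only [toReal] at this
      exact_mod_cast this
    have h1 : ∀ r, |x.1 r| ≤ (B : ℤ) := fun r => hb x y r (hw ▸ hB)
    have h2 : ∀ r, |y.1 r| ≤ (B : ℤ) := fun r => hb y x r (by linarith)
    exact ⟨⟨fun r => (abs_le.mp (h1 r)).1, fun r => (abs_le.mp (h1 r)).2⟩,
      ⟨fun r => (abs_le.mp (h2 r)).1, fun r => (abs_le.mp (h2 r)).2⟩⟩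
  · rintro ⟨x, y⟩ _ ⟨x', y'⟩ _ h
    simp only [Prod.mk.injEq] at h
    exact Prod.ext (Subtype.ext h.1) (Subtype.ext h.2)

instance {N n : ℕ} (a : Fin N ↪ (Fin n → ℤ)) : Finset.HasAntidiagonal (latticeCone a) where
  antidiagonal k := (finite_decompositions a k).toFinset
  mem_antidiagonal := by simp

/-! ### The ring of formal series supported in the cone -/

/-- `𝓡`: the formal series `∑ b_l v^l` over `l ∈ L°` with integer coefficients `b_l`. -/
@[ext] structure ConeSeries {N n : ℕ} (a : Fin N ↪ (Fin n → ℤ)) where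
  /-- The coefficients `b_l`. -/
  coeff : latticeCone a → ℤ

namespace ConeSeries

variable {N n : ℕ} {a : Fin N ↪ (Fin n → ℤ)}

instance : Zero (ConeSeries a) := ⟨⟨fun _ => 0⟩⟩
instance : Add (ConeSeries a) := ⟨fun f g => ⟨fun l => f.coeff l + g.coeff l⟩⟩
instance : Neg (ConeSeries a) := ⟨fun f => ⟨fun l => -f.coeff l⟩⟩
open Classical in
instance : One (ConeSeries a) := ⟨⟨fun l => if l = 0 then 1 else 0⟩⟩

/-- The product of formal series: `v^x * v^y = v^(x + y)`. -/
instance : Mul (ConeSeries a) :=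
  ⟨fun f g => ⟨fun l => ∑ x ∈ Finset.HasAntidiagonal.antidiagonal l, f.coeff x.1 * g.coeff x.2⟩⟩

theorem coeff_zero (l : latticeCone a) : (0 : ConeSeries a).coeff l = 0 := rfl

theorem coeff_add (f g : ConeSeries a) (l : latticeCone a) :
    (f + g).coeff l = f.coeff l + g.coeff l := rfl

theorem coeff_neg (f : ConeSeries a) (l : latticeCone a) : (-f).coeff l = -f.coeff l := rfl

open Classical in
theorem coeff_one (l : latticeCone a) : (1 : ConeSeries a).coeff l = if l = 0 then 1 else 0 := rfl

theorem coeff_mul (f g : ConeSeries a) (l : latticeCone a) : (f * g).coeff l =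
    ∑ x ∈ Finset.HasAntidiagonal.antidiagonal l, f.coeff x.1 * g.coeff x.2 := rfl

theorem mul_comm' (f g : ConeSeries a) : f * g = g * f := by
  ext l
  rw [coeff_mul, coeff_mul]
  refine Finset.sum_nbij' Prod.swap Prod.swap ?_ ?_ ?_ ?_ ?_ <;>
    simp [add_comm, mul_comm]

theorem one_mul' (f : ConeSeries a) : 1 * f = f := by
  ext l
  rw [coeff_mul, Finset.sum_eq_single (0, l)]
  · simp [coeff_one]
  · rintro ⟨x, y⟩ hxy hne
    have hx : x ≠ 0 := by
      rintro rfl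
      rw [Finset.HasAntidiagonal.mem_antidiagonal] at hxy
      simp only [zero_add] at hxy
      exact hne (by rw [hxy])
    simp [coeff_one, hx]
  · intro h
    exact absurd (Finset.HasAntidiagonal.mem_antidiagonal.mpr (zero_add l)) h

theorem mul_assoc' (f g h : ConeSeries a) : f * g * h = f * (g * h) := by
  ext l
  simp only [coeff_mul, Finset.sum_mul, Finset.mul_sum, Finset.sum_sigma']
  apply Finset.sum_nbij' (fun ⟨⟨_i, j⟩, ⟨k, l⟩⟩ ↦ ⟨(k, l + j), (l, j)⟩)
    (fun ⟨⟨i, _j⟩, ⟨k, l⟩⟩ ↦ ⟨(i + k, l), (i, k)⟩) <;>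
    simp only [Finset.mem_sigma, Finset.HasAntidiagonal.mem_antidiagonal, Sigma.forall,
      Prod.forall] <;>
    rintro x y z w ⟨h1, h2⟩ <;> subst h1 <;> subst h2 <;>
    simp [add_assoc, mul_assoc]

theorem mul_add' (f g h : ConeSeries a) : f * (g + h) = f * g + f * h := by
  ext l
  simp only [coeff_mul, coeff_add, mul_add, Finset.sum_add_distrib]

instance : CommRing (ConeSeries a) where
  add_assoc f g h := by ext l; simp only [coeff_add, add_assoc]
  zero_add f := by ext l; simp only [coeff_add, coeff_zero, zero_add]
  add_zero f := by ext l; simp only [coeff_add, coeff_zero, add_zero]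
  add_comm f g := by ext l; simp only [coeff_add, add_comm]
  neg_add_cancel f := by ext l; simp only [coeff_add, coeff_neg, coeff_zero, neg_add_cancel]
  nsmul := nsmulRec
  zsmul := zsmulRec
  mul_assoc := mul_assoc'
  one_mul := one_mul'
  mul_one f := by rw [mul_comm', one_mul']
  mul_comm := mul_comm'
  left_distrib := mul_add'
  right_distrib f g h := by rw [mul_comm', mul_add', mul_comm' h f, mul_comm' h g]
  zero_mul f := by ext l; simp only [coeff_mul, coeff_zero, zero_mul, Finset.sum_const_zero]
  mul_zero f := by ext l; simp only [coeff_mul, coeff_zero, mul_zero, Finset.sum_const_zero]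

end ConeSeries

/-! ### The Frobenius lift and the derivations -/

/-- The coefficient of `v^l` in `∑ b_k v^(p k)`. -/
def frobCoeff {N n : ℕ} (a : Fin N ↪ (Fin n → ℤ)) (p : ℕ) (b : ConeSeries a) : ConeSeries a :=
  open Classical in
  ⟨fun l => if h : ∃ k : latticeCone a, p • k = l then b.coeff h.choose else 0⟩

theorem nsmul_inj {N n : ℕ} {a : Fin N ↪ (Fin n → ℤ)} {p : ℕ} (hp : p ≠ 0) {x y : latticeCone a}
    (h : p • x = p • y) : x = y := by
  apply Subtype.ext
  have h' : p • (x : Fin N → ℤ) = p • (y : Fin N → ℤ) := congrArg Subtype.val h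
  funext r
  have := congrFun h' r
  simpa [hp] using this

theorem frobCoeff_nsmul {N n : ℕ} {a : Fin N ↪ (Fin n → ℤ)} {p : ℕ} (hp : p ≠ 0)
    (b : ConeSeries a) (k : latticeCone a) : (frobCoeff a p b).coeff (p • k) = b.coeff k := by
  have h : ∃ k' : latticeCone a, p • k' = p • k := ⟨k, rfl⟩
  simp only [frobCoeff, dif_pos h]
  exact congrArg b.coeff (nsmul_inj hp h.choose_spec)

theorem frobCoeff_of_not {N n : ℕ} {a : Fin N ↪ (Fin n → ℤ)} {p : ℕ}
    (b : ConeSeries a) (l : latticeCone a) (h : ¬ ∃ k : latticeCone a, p • k = l) :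
    (frobCoeff a p b).coeff l = 0 := by
  simp only [frobCoeff, dif_neg h]

theorem exists_nsmul_of_add {N n : ℕ} {a : Fin N ↪ (Fin n → ℤ)} {p : ℕ} (hp : p ≠ 0)
    {x y k : latticeCone a} (h : p • x + y = p • k) : ∃ z, p • z = y := by
  have h' : p • (x : Fin N → ℤ) + y = p • (k : Fin N → ℤ) := congrArg Subtype.val h
  have hy : toReal (y : Fin N → ℤ) = (p : ℝ) • toReal ((k : Fin N → ℤ) - (x : Fin N → ℤ)) := by
    funext r
    have := congrFun h' r
    rw [Pi.add_apply, Pi.smul_apply, Pi.smul_apply, nsmul_eq_mul, nsmul_eq_mul] at this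
    have h2 : (y : Fin N → ℤ) r = p * ((k : Fin N → ℤ) r - (x : Fin N → ℤ) r) := by linarith
    simp [toReal, h2]
  have hmem : (k : Fin N → ℤ) - (x : Fin N → ℤ) ∈ latticeCone a := by
    change toReal _ ∈ realCone a
    have hy2 : toReal (y : Fin N → ℤ) ∈ realCone a := y.2
    have : toReal ((k : Fin N → ℤ) - (x : Fin N → ℤ))
        = (⟨(p : ℝ)⁻¹, by positivity⟩ : {c : ℝ // 0 ≤ c}) • toReal (y : Fin N → ℤ) := by
      rw [hy, Nonneg.mk_smul, smul_smul, inv_mul_cancel₀ (by exact_mod_cast hp), one_smul]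
    rw [this]
    exact Submodule.smul_mem _ _ hy2
  refine ⟨⟨_, hmem⟩, Subtype.ext ?_⟩
  change p • ((k : Fin N → ℤ) - (x : Fin N → ℤ)) = y
  rw [smul_sub, ← h']
  abel

/-- The Frobenius lift `σ : 𝓡 → 𝓡` with `v_j ↦ v_j ^ p`, that is `∑ b_k v^k ↦ ∑ b_k v^(p k)`. -/
def frob {N n : ℕ} (a : Fin N ↪ (Fin n → ℤ)) (p : ℕ) [hp : Fact p.Prime] :
    ConeSeries a →+* ConeSeries a where
  toFun := frobCoeff a p
  map_zero' := by
    ext l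
    by_cases h : ∃ k : latticeCone a, p • k = l
    · obtain ⟨k, rfl⟩ := h
      rw [frobCoeff_nsmul hp.out.ne_zero]; rfl
    · rw [frobCoeff_of_not _ _ h]; rfl
  map_add' f g := by
    ext l
    by_cases h : ∃ k : latticeCone a, p • k = l
    · obtain ⟨k, rfl⟩ := h
      simp only [ConeSeries.coeff_add, frobCoeff_nsmul hp.out.ne_zero]
    · simp only [ConeSeries.coeff_add, frobCoeff_of_not _ _ h, add_zero]
  map_one' := by
    ext l
    by_cases h : ∃ k : latticeCone a, p • k = l
    · obtain ⟨k, rfl⟩ := h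
      rw [frobCoeff_nsmul hp.out.ne_zero]
      have : p • k = 0 ↔ k = 0 := by
        refine ⟨fun h => nsmul_inj hp.out.ne_zero (h.trans (smul_zero p).symm), ?_⟩
        rintro rfl
        exact smul_zero p
      simp only [ConeSeries.coeff_one, this]
    · rw [frobCoeff_of_not _ _ h, ConeSeries.coeff_one, if_neg]
      intro hl
      exact h ⟨0, by rw [smul_zero]; exact hl.symm⟩
  map_mul' f g := by
    have hp0 := hp.out.ne_zero
    ext l
    by_cases h : ∃ k : latticeCone a, p • k = l
    · obtain ⟨k, rfl⟩ := h
      rw [frobCoeff_nsmul hp0, ConeSeries.coeff_mul, ConeSeries.coeff_mul]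
      refine Finset.sum_of_injOn (fun x => (p • x.1, p • x.2)) ?_ ?_ ?_ ?_
      · rintro ⟨x, y⟩ _ ⟨x', y'⟩ _ hxy
        simp only [Prod.mk.injEq] at hxy
        exact Prod.ext (nsmul_inj hp0 hxy.1) (nsmul_inj hp0 hxy.2)
      · rintro ⟨x, y⟩ hxy
        simp only [Finset.mem_coe, Finset.HasAntidiagonal.mem_antidiagonal] at hxy ⊢
        rw [← smul_add, hxy]
      · rintro ⟨x, y⟩ hxy hn
        by_cases hx : ∃ x', p • x' = x
        · obtain ⟨x', rfl⟩ := hx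
          have hxy' := Finset.HasAntidiagonal.mem_antidiagonal.mp hxy
          obtain ⟨y', rfl⟩ := exists_nsmul_of_add hp0 hxy'
          refine absurd ⟨(x', y'), ?_, rfl⟩ hn
          simp only [Finset.mem_coe, Finset.HasAntidiagonal.mem_antidiagonal]
          simp only [← smul_add] at hxy'
          exact nsmul_inj hp0 hxy'
        · simp only [frobCoeff_of_not f x hx, zero_mul]
      · rintro ⟨x, y⟩ _
        simp only [frobCoeff_nsmul hp0]
    · rw [frobCoeff_of_not _ _ h, ConeSeries.coeff_mul]
      refine (Finset.sum_eq_zero ?_).symm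
      rintro ⟨x, y⟩ hxy
      by_cases hx : ∃ x', p • x' = x
      · by_cases hy : ∃ y', p • y' = y
        · obtain ⟨x', rfl⟩ := hx
          obtain ⟨y', rfl⟩ := hy
          refine absurd ⟨x' + y', ?_⟩ h
          rw [smul_add]
          exact Finset.HasAntidiagonal.mem_antidiagonal.mp hxy
        · simp only [frobCoeff_of_not g y hy, mul_zero]
      · simp only [frobCoeff_of_not f x hx, zero_mul]

/-- The derivation `δ = v_s ∂/∂v_s` of `𝓡`, that is `∑ b_l v^l ↦ ∑ l_s b_l v^l`. -/
def eulerDer {N n : ℕ} (a : Fin N ↪ (Fin n → ℤ)) (s : Fin N) :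
    Derivation ℤ (ConeSeries a) (ConeSeries a) :=
  Derivation.mk'
    (AddMonoidHom.toIntLinearMap
      { toFun := fun b => ⟨fun l => (l : Fin N → ℤ) s * b.coeff l⟩
        map_zero' := by ext l; simp [ConeSeries.coeff_zero]
        map_add' := fun f g => by ext l; simp [ConeSeries.coeff_add, mul_add] })
    (by
      intro f g
      ext l
      simp only [AddMonoidHom.coe_toIntLinearMap, AddMonoidHom.coe_mk, ZeroHom.coe_mk,
        smul_eq_mul, ConeSeries.coeff_add]
      rw [mul_comm g]
      simp only [ConeSeries.coeff_mul, Finset.mul_sum, ← Finset.sum_add_distrib]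
      refine Finset.sum_congr rfl fun x hx => ?_
      have : (l : Fin N → ℤ) s = (x.1 : Fin N → ℤ) s + (x.2 : Fin N → ℤ) s := by
        rw [← Finset.HasAntidiagonal.mem_antidiagonal.mp hx]; rfl
      rw [this]
      ring)

theorem eulerDer_apply {N n : ℕ} (a : Fin N ↪ (Fin n → ℤ)) (s : Fin N) (b : ConeSeries a)
    (l : latticeCone a) : (eulerDer a s b).coeff l = (l : Fin N → ℤ) s * b.coeff l := rfl

/-! ### The generic Laurent polynomial and its periods -/

/-- Laurent polynomials with integer coefficients in `v_1, …, v_N` and `x_1, …, x_n`. -/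
abbrev Laurent (N n : ℕ) : Type := AddMonoidAlgebra ℤ ((Fin N → ℤ) × (Fin n → ℤ))

/-- The Laurent monomial `v^l x^u`. -/
def mono {N n : ℕ} (l : Fin N → ℤ) (u : Fin n → ℤ) : Laurent N n :=
  AddMonoidAlgebra.single (l, u) 1

/-- The exponent of the variable `v_r`. -/
def e {N : ℕ} (r : Fin N) : Fin N → ℤ := Pi.single r 1

/-- The Laurent polynomial `f = ∑ r, v_r x^(a r)` with independent coefficients `v_r`. -/
def genericPoly {N n : ℕ} (a : Fin N ↪ (Fin n → ℤ)) : Laurent N n := ∑ r, mono (e r) (a r)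

/-- The constant term with respect to `x` of `g`, as the family of coefficients of the `v^l`. -/
def constTerm {N n : ℕ} (g : Laurent N n) (l : Fin N → ℤ) : ℤ := g.coeff (l, 0)

/-- The term of degree `k` in the expansion of `ω_u = x^u / f` with respect to `a i`:
`x^(u - a i) / v_i * (-1)^k * (∑ r ≠ i, (v_r / v_i) x^(a r - a i))^k`. -/
def expansionTerm {N n : ℕ} (a : Fin N ↪ (Fin n → ℤ)) (i : Fin N) (u : Fin n → ℤ) (k : ℕ) :
    Laurent N n :=
  mono (-e i) (u - a i) *
    ((-1) ^ k * (∑ r ∈ Finset.univ.erase i, mono (e r - e i) (a r - a i)) ^ k)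

/-- The period `p_{a_i}(ω_u)`: the constant term with respect to `x` of the expansion of `x^u / f`
with respect to `a i`, as the family of coefficients of the `v^l`. Each coefficient gets a
contribution from at most one `k`. -/
def period {N n : ℕ} (a : Fin N ↪ (Fin n → ℤ)) (i : Fin N) (u : Fin n → ℤ) (l : Fin N → ℤ) : ℤ :=
  ∑ᶠ k : ℕ, constTerm (expansionTerm a i u k) l

/-- The Laurent polynomial `(1 - (1 - f / (v_i x^(a i)))^m) * x^u / f`, with the division by `f`
carried out. -/
def truncatedForm {N n : ℕ} (a : Fin N ↪ (Fin n → ℤ)) (i : Fin N) (u : Fin n → ℤ) (m : ℕ) :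
    Laurent N n :=
  mono (-e i) (u - a i) *
    ∑ k ∈ Finset.range m, (1 - genericPoly a * mono (-e i) (-a i)) ^ k

theorem mono_mul_mono {N n : ℕ} (l l' : Fin N → ℤ) (u u' : Fin n → ℤ) :
    mono l u * mono l' u' = mono (l + l') (u + u') := by
  simp [mono]

theorem truncatedForm_mul {N n : ℕ} (a : Fin N ↪ (Fin n → ℤ)) (i : Fin N) (u : Fin n → ℤ)
    (m : ℕ) : truncatedForm a i u m * genericPoly a =
      (1 - (1 - genericPoly a * mono (-e i) (-a i)) ^ m) * mono 0 u := by
  have h : (mono (-e i) (u - a i) : Laurent N n) = mono (-e i) (-a i) * mono 0 u := by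
    rw [mono_mul_mono]; simp [sub_eq_neg_add]
  have h2 := mul_neg_geom_sum (1 - genericPoly a * mono (-e i) (-a i)) m
  rw [sub_sub_cancel] at h2
  rw [truncatedForm, h, ← h2]
  ring

/-- `(Ψ̃)_{ji} = v_j p_{a_i}(ω_{a_j})` as an element of `𝓡`. -/
def PsiEntry {N n : ℕ} (a : Fin N ↪ (Fin n → ℤ)) (j i : Fin N) : ConeSeries a :=
  ⟨fun l => period a i (a j) (l - e j)⟩

/-- `(ψ̃_m)_{ji} = v_j (ψ_m)_{ji}` as an element of `𝓡`, where `(ψ_m)_{ji}` is the constant term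
with respect to `x` of `(1 - (1 - f / (v_i x^(a i)))^m) * x^(a j) / f`. -/
def psiEntry {N n : ℕ} (a : Fin N ↪ (Fin n → ℤ)) (m : ℕ) (j i : Fin N) : ConeSeries a :=
  ⟨fun l => constTerm (truncatedForm a i (a j) m) (l - e j)⟩

/-! Consistency facts: all constant terms above are supported in `L_i`, which lies in `L°`, each
coefficient of `period` comes from a single term of the expansion, `truncatedForm` is the sum of
the first `m` terms of that expansion, and the coefficients of `PsiEntry` are given by `Γ*`. -/

theorem mono_pow {N n : ℕ} (l : Fin N → ℤ) (u : Fin n → ℤ) (k : ℕ) :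
    mono l u ^ k = mono ((k : ℤ) • l) ((k : ℤ) • u) := by
  induction k with
  | zero => simp [mono, AddMonoidAlgebra.one_def]; rfl
  | succ k ih =>
    rw [pow_succ, ih, mono_mul_mono]
    push_cast
    rw [add_smul, add_smul, one_smul, one_smul]

theorem mono_prod {N n : ℕ} {ι : Type*} (s : Finset ι) (l : ι → Fin N → ℤ) (u : ι → Fin n → ℤ) :
    ∏ r ∈ s, mono (l r) (u r) = mono (∑ r ∈ s, l r) (∑ r ∈ s, u r) := by
  classical
  induction s using Finset.induction_on with
  | empty => simp [mono, AddMonoidAlgebra.one_def]; rfl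
  | insert r s hr ih => rw [Finset.prod_insert hr, Finset.sum_insert hr, Finset.sum_insert hr, ih,
      mono_mul_mono]

theorem constTerm_expansionTerm {N n : ℕ} (a : Fin N ↪ (Fin n → ℤ)) (i : Fin N) (u : Fin n → ℤ)
    (k : ℕ) (l : Fin N → ℤ) : constTerm (expansionTerm a i u k) l =
      ∑ κ ∈ Finset.piAntidiag (Finset.univ.erase i) k,
        if -e i + ∑ r ∈ Finset.univ.erase i, (κ r : ℤ) • (e r - e i) = l ∧
            u - a i + ∑ r ∈ Finset.univ.erase i, (κ r : ℤ) • (a r - a i) = 0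
        then (-1) ^ k * (Nat.multinomial (Finset.univ.erase i) κ : ℤ) else 0 := by
  have h1 : expansionTerm a i u k = ∑ κ ∈ Finset.piAntidiag (Finset.univ.erase i) k,
      AddMonoidAlgebra.single (-e i + ∑ r ∈ Finset.univ.erase i, (κ r : ℤ) • (e r - e i),
        u - a i + ∑ r ∈ Finset.univ.erase i, (κ r : ℤ) • (a r - a i))
        ((-1) ^ k * (Nat.multinomial (Finset.univ.erase i) κ : ℤ)) := by
    rw [expansionTerm, Finset.sum_pow_eq_sum_piAntidiag, Finset.mul_sum, Finset.mul_sum]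
    refine Finset.sum_congr rfl fun κ _ => ?_
    simp only [mono_pow]
    rw [mono_prod]
    have : ((-1) ^ k * (Nat.multinomial (Finset.univ.erase i) κ : Laurent N n)) =
        AddMonoidAlgebra.single 0 ((-1) ^ k * (Nat.multinomial (Finset.univ.erase i) κ : ℤ)) := by
      have := map_intCast (AddMonoidAlgebra.singleZeroRingHom (R := ℤ)
        (M := (Fin N → ℤ) × (Fin n → ℤ)))
        ((-1) ^ k * (Nat.multinomial (Finset.univ.erase i) κ : ℤ))
      simp only [Int.cast_eq] at this
      push_cast at this
      exact this.symm
    rw [← mul_assoc ((-1 : Laurent N n) ^ k), this]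
    simp only [mono, AddMonoidAlgebra.single_mul_single]
    simp
  rw [constTerm, h1, AddMonoidAlgebra.coeff_sum, Finsupp.finsetSum_apply]
  refine Finset.sum_congr rfl fun κ _ => ?_
  rw [AddMonoidAlgebra.coeff_single, Finsupp.single_apply]
  simp only [Prod.mk.injEq]

theorem sum_smul_e {N : ℕ} (i : Fin N) (κ : Fin N → ℕ) (s : Fin N) :
    (∑ r ∈ Finset.univ.erase i, (κ r : ℤ) • (e r - e i)) s =
      if s = i then -((∑ r ∈ Finset.univ.erase i, κ r : ℕ) : ℤ) else (κ s : ℤ) := by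
  rw [Finset.sum_apply]
  split_ifs with h
  · subst h
    push_cast
    rw [← Finset.sum_neg_distrib]
    refine Finset.sum_congr rfl fun r hr => ?_
    simp [e, (Finset.ne_of_mem_erase hr).symm]
  · rw [Finset.sum_eq_single s]
    · simp [e, h]
    · intro r _ hr
      simp [e, h, hr.symm]
    · intro hs
      exact absurd (Finset.mem_erase.mpr ⟨h, Finset.mem_univ s⟩) hs

theorem sum_homog_eq_zero_iff {N n : ℕ} (a : Fin N ↪ (Fin n → ℤ)) (l : Fin N → ℤ) :
    ∑ r, l r • homog (a r) = 0 ↔ ∑ r, l r = 0 ∧ ∑ r, l r • a r = 0 := by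
  constructor
  · intro h
    refine ⟨by simpa [homog, Finset.sum_apply] using congrFun h 0, funext fun d => ?_⟩
    simpa [homog, Finset.sum_apply] using congrFun h d.succ
  · rintro ⟨h0, h1⟩
    funext d
    refine Fin.cases ?_ (fun d => ?_) d
    · simpa [homog, Finset.sum_apply] using h0
    · simpa [homog, Finset.sum_apply] using congrFun h1 d

theorem expansion_index {N n : ℕ} (a : Fin N ↪ (Fin n → ℤ)) (i j : Fin N) (k : ℕ)
    (κ : Fin N → ℕ) (hκ : ∑ r ∈ Finset.univ.erase i, κ r = k) (l : Fin N → ℤ) :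
    (-e i + ∑ r ∈ Finset.univ.erase i, (κ r : ℤ) • (e r - e i) = l - e j ∧
      a j - a i + ∑ r ∈ Finset.univ.erase i, (κ r : ℤ) • (a r - a i) = 0) ↔
    (l ∈ relations a i ∧ (∀ r, r ≠ i → l r = κ r + e j r) ∧ (k : ℤ) = e j i - 1 - l i) := by
  have hl : (-e i + ∑ r ∈ Finset.univ.erase i, (κ r : ℤ) • (e r - e i) = l - e j) ↔
      ((∀ r, r ≠ i → l r = κ r + e j r) ∧ (k : ℤ) = e j i - 1 - l i) := by
    rw [funext_iff]
    constructor
    · intro h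
      refine ⟨fun r hr => ?_, ?_⟩
      · have := h r
        rw [Pi.add_apply, sum_smul_e, if_neg hr] at this
        simp [e, hr] at this
        simp [e]
        linarith
      · have := h i
        rw [Pi.add_apply, sum_smul_e, if_pos rfl, hκ] at this
        simp [e] at this
        simp [e]
        linarith
    · rintro ⟨h1, h2⟩ s
      rw [Pi.add_apply, sum_smul_e, hκ]
      by_cases hs : s = i
      · subst hs
        simp [e] at h2 ⊢
        linarith
      · have := h1 s hs
        simp [e, hs] at this ⊢
        linarith
  have hsum : ∀ l : Fin N → ℤ, (∀ r, r ≠ i → l r = κ r + e j r) → (k : ℤ) = e j i - 1 - l i →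
      ∑ r, l r = 0 ∧ ∑ r, l r • a r =
        a j - a i + ∑ r ∈ Finset.univ.erase i, (κ r : ℤ) • (a r - a i) := by
    intro l h1 h2
    have hli : l i = e j i - 1 - (∑ r ∈ Finset.univ.erase i, (κ r : ℤ)) := by
      rw [← hκ] at h2
      push_cast at h2
      linarith
    have hej : ∑ r ∈ Finset.univ.erase i, e j r + e j i = 1 := by
      rw [Finset.sum_erase_add _ _ (Finset.mem_univ i)]
      simp [e]
    have heja : ∑ r ∈ Finset.univ.erase i, e j r • a r + e j i • a i = a j := by
      rw [Finset.sum_erase_add _ _ (Finset.mem_univ i)]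
      simp [e, Pi.single_apply]
    constructor
    · rw [← Finset.sum_erase_add _ _ (Finset.mem_univ i), hli,
        Finset.sum_congr rfl fun r hr => h1 r (Finset.ne_of_mem_erase hr),
        Finset.sum_add_distrib]
      linarith
    · rw [← Finset.sum_erase_add _ _ (Finset.mem_univ i), hli,
        Finset.sum_congr rfl fun r hr => by rw [h1 r (Finset.ne_of_mem_erase hr), add_smul],
        Finset.sum_add_distrib]
      rw [← heja]
      simp only [smul_sub, Finset.sum_sub_distrib, ← Finset.sum_smul, sub_smul, one_smul]
      abel
  rw [hl]
  constructor
  · rintro ⟨⟨h1, h2⟩, h3⟩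
    obtain ⟨h4, h5⟩ := hsum l h1 h2
    refine ⟨⟨(sum_homog_eq_zero_iff a l).mpr ⟨h4, h5.trans h3⟩, fun r hr => ?_⟩, h1, h2⟩
    rw [h1 r hr]
    have : 0 ≤ e j r := by simp only [e, Pi.single_apply]; split_ifs <;> simp
    positivity
  · rintro ⟨⟨h0, -⟩, h1, h2⟩
    exact ⟨⟨h1, h2⟩, (hsum l h1 h2).2.symm.trans ((sum_homog_eq_zero_iff a l).mp h0).2⟩

theorem expansionTerm_support {N n : ℕ} (a : Fin N ↪ (Fin n → ℤ)) (i j : Fin N) (k : ℕ)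
    (l : Fin N → ℤ) (h : constTerm (expansionTerm a i (a j) k) (l - e j) ≠ 0) :
    l ∈ relations a i ∧ (k : ℤ) = e j i - 1 - l i := by
  rw [constTerm_expansionTerm] at h
  obtain ⟨κ, hκ, hne⟩ := Finset.exists_ne_zero_of_sum_ne_zero h
  have hc := (ite_ne_right_iff.mp hne).1
  have := (expansion_index a i j k κ (Finset.mem_piAntidiag.mp hκ).1 l).mp hc
  exact ⟨this.1, this.2.2⟩

theorem truncatedForm_eq_sum {N n : ℕ} (a : Fin N ↪ (Fin n → ℤ)) (i : Fin N) (u : Fin n → ℤ)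
    (m : ℕ) : truncatedForm a i u m = ∑ k ∈ Finset.range m, expansionTerm a i u k := by
  rw [truncatedForm, Finset.mul_sum]
  refine Finset.sum_congr rfl fun k _ => ?_
  have h : 1 - genericPoly a * mono (-e i) (-a i) =
      -∑ r ∈ Finset.univ.erase i, mono (e r - e i) (a r - a i) := by
    rw [genericPoly, Finset.sum_mul, ← Finset.sum_erase_add _ _ (Finset.mem_univ i)]
    simp only [mono_mul_mono, ← sub_eq_add_neg, sub_self]
    have : (mono 0 0 : Laurent N n) = 1 := rfl
    rw [this]
    ring
  rw [expansionTerm, h, neg_pow]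

theorem psiEntry_support {N n : ℕ} (a : Fin N ↪ (Fin n → ℤ)) (i j : Fin N) (m : ℕ)
    (l : Fin N → ℤ) (h : constTerm (truncatedForm a i (a j) m) (l - e j) ≠ 0) :
    l ∈ relations a i := by
  rw [truncatedForm_eq_sum, constTerm, AddMonoidAlgebra.coeff_sum, Finsupp.finsetSum_apply] at h
  obtain ⟨k, -, hk⟩ := Finset.exists_ne_zero_of_sum_ne_zero h
  exact (expansionTerm_support a i j k l hk).1

theorem period_support {N n : ℕ} (a : Fin N ↪ (Fin n → ℤ)) (i j : Fin N)
    (l : Fin N → ℤ) (h : period a i (a j) (l - e j) ≠ 0) : l ∈ relations a i := by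
  obtain ⟨k, hk⟩ : ∃ k, constTerm (expansionTerm a i (a j) k) (l - e j) ≠ 0 := by
    by_contra hc
    push Not at hc
    exact h (by simp [period, hc])
  exact (expansionTerm_support a i j k l hk).1

/-- `Γ*(t) = (t-1)!` for `t ≥ 1` and `Γ*(t) = (-1)^t / |t|!` for `t ≤ 0`. -/
def gammaStar (t : ℤ) : ℚ :=
  if 1 ≤ t then ((t - 1).toNat.factorial : ℚ) else (-1) ^ t / (t.natAbs.factorial : ℚ)

open Classical in
theorem coeff_PsiEntry {N n : ℕ} (a : Fin N ↪ (Fin n → ℤ)) (j i : Fin N) (l : latticeCone a) :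
    ((PsiEntry a j i).coeff l : ℚ) = (if i = j ∧ l = 0 then 1 else 0) +
      if (l : Fin N → ℤ) ∈ relations a i ∧ l ≠ 0 then
        ((l : Fin N → ℤ) j : ℚ) * ∏ r, (gammaStar ((l : Fin N → ℤ) r + 1))⁻¹ else 0 := by
  obtain ⟨l, hlc⟩ := l
  have hz : ((⟨l, hlc⟩ : latticeCone a) = 0) ↔ l = 0 := by
    rw [Subtype.ext_iff]; rfl
  simp only [PsiEntry, hz, ne_eq]
  by_cases hl : l ∈ relations a i
  swap
  · have h0 : period a i (a j) (l - e j) = 0 := by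
      by_contra h; exact hl (period_support a i j l h)
    have hl0 : l ≠ 0 := by
      rintro rfl; exact hl ⟨by simp, by simp⟩
    simp [h0, hl, hl0]
  obtain ⟨h0, -⟩ := (sum_homog_eq_zero_iff a l).mp hl.1
  have hsE : l i = -∑ r ∈ Finset.univ.erase i, l r := by
    rw [← Finset.sum_erase_add _ _ (Finset.mem_univ i)] at h0
    linarith
  -- the value when a multi-index exists
  have hval : ∀ κ : Fin N → ℕ, (∀ r, r ≠ i → l r = κ r + e j r) → κ i = 0 →
      period a i (a j) (l - e j) = (-1) ^ (∑ r ∈ Finset.univ.erase i, κ r) *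
        (Nat.multinomial (Finset.univ.erase i) κ : ℤ) := by
    intro κ hκ hκi
    have hk : ((∑ r ∈ Finset.univ.erase i, κ r : ℕ) : ℤ) = e j i - 1 - l i := by
      have hej : ∑ r ∈ Finset.univ.erase i, e j r + e j i = 1 := by
        rw [Finset.sum_erase_add _ _ (Finset.mem_univ i)]
        simp [e]
      rw [hsE, Finset.sum_congr rfl fun r hr => hκ r (Finset.ne_of_mem_erase hr),
        Finset.sum_add_distrib]
      push_cast
      linarith
    rw [period, finsum_eq_single _ (∑ r ∈ Finset.univ.erase i, κ r), constTerm_expansionTerm,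
      Finset.sum_eq_single κ]
    · rw [if_pos ((expansion_index a i j _ κ rfl l).mpr ⟨hl, hκ, hk⟩)]
    · intro κ' hκ' hne
      rw [if_neg]
      intro hc
      rw [Finset.mem_piAntidiag] at hκ'
      have := (expansion_index a i j _ κ' hκ'.1 l).mp hc
      refine hne (funext fun r => ?_)
      by_cases hr : r = i
      · subst hr
        rw [hκi]
        by_contra hn
        exact absurd (hκ'.2 r hn) (by simp)
      · have h1 := this.2.1 r hr
        have h2 := hκ r hr
        omega
    · intro hn
      refine absurd (Finset.mem_piAntidiag.mpr ⟨rfl, fun r hr => ?_⟩) hn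
      refine Finset.mem_erase.mpr ⟨?_, Finset.mem_univ r⟩
      rintro rfl
      exact hr hκi
    · intro k' hk'
      by_contra hn
      have := (expansionTerm_support a i j k' l hn).2
      exact hk' (by omega)
  have hfac : ∀ r, r ≠ i → gammaStar (l r + 1) = ((l r).toNat.factorial : ℚ) := by
    intro r hr
    have := hl.2 r hr
    rw [gammaStar, if_pos (by omega)]
    simp
  have hprod : ∀ κ : Fin N → ℕ, ((Nat.multinomial (Finset.univ.erase i) κ : ℕ) : ℚ) *
      ∏ r ∈ Finset.univ.erase i, ((κ r).factorial : ℚ) =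
        (∑ r ∈ Finset.univ.erase i, κ r).factorial := by
    intro κ
    have := Nat.multinomial_spec (Finset.univ.erase i) κ
    rw [mul_comm]
    exact_mod_cast this
  by_cases hij : i = j
  · subst hij
    set κ : Fin N → ℕ := fun r => if r = i then 0 else (l r).toNat with hκd
    have hκ : ∀ r, r ≠ i → l r = κ r + e i r := by
      intro r hr
      have := hl.2 r hr
      simp [hκd, hr, e, this]
    have hκl : ∑ r ∈ Finset.univ.erase i, ((κ r : ℕ) : ℤ) = -l i := by
      rw [hsE, neg_neg]
      refine Finset.sum_congr rfl fun r hr => ?_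
      have hr := Finset.ne_of_mem_erase hr
      simp [hκd, hr, hl.2 r hr]
    rw [hval κ hκ (by simp [hκd])]
    by_cases hl0 : l = 0
    · subst hl0
      have : κ = 0 := by funext r; simp [hκd]
      have h1 : Nat.multinomial (Finset.univ.erase i) (0 : Fin N → ℕ) = 1 := by
        simp [Nat.multinomial]
      simp [this, h1]
    · set K := ∑ r ∈ Finset.univ.erase i, κ r with hK
      have hKl : l i = -(K : ℤ) := by rw [hK]; push_cast; linarith
      have hKpos : K ≠ 0 := by
        intro h
        refine hl0 (funext fun r => ?_)
        by_cases hr : r = i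
        · subst hr; rw [hKl, h]; rfl
        · have : κ r = 0 := (Finset.sum_eq_zero_iff.mp h) r
            (Finset.mem_erase.mpr ⟨hr, Finset.mem_univ r⟩)
          rw [hκ r hr, this]; simp [e, hr]
      have hgi : (gammaStar (l i + 1))⁻¹ = (-1) ^ (K + 1) * ((K - 1).factorial : ℚ) := by
        have hn : (l i + 1).natAbs = K - 1 := by omega
        have hp : ((-1 : ℚ) ^ (l i + 1)) = (-1) ^ (K + 1) := by
          have : l i + 1 = ((K + 1 : ℕ) : ℤ) + 2 * (-K) := by push_cast; omega
          rw [this, zpow_add₀ (by norm_num), zpow_mul]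
          simp only [zpow_natCast]
          norm_num
        rw [gammaStar, if_neg (by omega), hn, hp, inv_div, div_eq_mul_inv, mul_comm, ← inv_pow]
        norm_num
      have hpi : ∏ r ∈ Finset.univ.erase i, (gammaStar (l r + 1))⁻¹ =
          (∏ r ∈ Finset.univ.erase i, ((κ r).factorial : ℚ))⁻¹ := by
        rw [← Finset.prod_inv_distrib]
        refine Finset.prod_congr rfl fun r hr => ?_
        have hr := Finset.ne_of_mem_erase hr
        rw [hfac r hr]
        simp [hκd, hr]
      have hne : ∏ r ∈ Finset.univ.erase i, ((κ r).factorial : ℚ) ≠ 0 :=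
        Finset.prod_ne_zero_iff.mpr fun r _ => by positivity
      rw [if_neg (by tauto), if_pos ⟨hl, hl0⟩, zero_add,
        ← Finset.mul_prod_erase _ _ (Finset.mem_univ i), hpi, hgi]
      have hm := hprod κ
      rw [← hK, ← Nat.mul_factorial_pred hKpos] at hm
      push_cast at hm ⊢
      rw [eq_div_of_mul_eq hne hm, hKl]
      push_cast
      field_simp
      ring
  · rw [if_neg (by tauto), zero_add]
    by_cases hlj : l j = 0
    · have h0 : period a i (a j) (l - e j) = 0 := by
        by_contra h
        obtain ⟨k, hk⟩ : ∃ k, constTerm (expansionTerm a i (a j) k) (l - e j) ≠ 0 := by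
          by_contra hc
          push Not at hc
          exact h (by simp [period, hc])
        rw [constTerm_expansionTerm] at hk
        obtain ⟨κ, hκ, hne⟩ := Finset.exists_ne_zero_of_sum_ne_zero hk
        have hc := (ite_ne_right_iff.mp hne).1
        have := ((expansion_index a i j k κ (Finset.mem_piAntidiag.mp hκ).1 l).mp hc).2.1 j
          (Ne.symm hij)
        simp [e] at this
        omega
      simp [h0, hlj]
    have hljpos : 0 < l j := lt_of_le_of_ne (hl.2 j (Ne.symm hij)) (Ne.symm hlj)
    have hl0 : l ≠ 0 := by rintro rfl; simp at hlj
    set κ : Fin N → ℕ := fun r => if r = i then 0 else (l r - e j r).toNat with hκd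
    have hκ : ∀ r, r ≠ i → l r = κ r + e j r := by
      intro r hr
      have := hl.2 r hr
      by_cases hrj : r = j
      · subst hrj
        simp [hκd, hr, e]
        omega
      · simp [hκd, hr, e, hrj, this]
    rw [hval κ hκ (by simp [hκd])]
    set K := ∑ r ∈ Finset.univ.erase i, κ r with hK
    have hKl : l i = -(K : ℤ) - 1 := by
      have hej : ∑ r ∈ Finset.univ.erase i, e j r + e j i = 1 := by
        rw [Finset.sum_erase_add _ _ (Finset.mem_univ i)]
        simp [e]
      have : e j i = 0 := by simp [e, hij]
      rw [hsE, Finset.sum_congr rfl fun r hr => hκ r (Finset.ne_of_mem_erase hr),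
        Finset.sum_add_distrib, hK]
      push_cast
      linarith
    have hgi : (gammaStar (l i + 1))⁻¹ = (-1) ^ K * (K.factorial : ℚ) := by
      have hn : (l i + 1).natAbs = K := by omega
      have hp : ((-1 : ℚ) ^ (l i + 1)) = (-1) ^ K := by
        have : l i + 1 = (K : ℤ) + 2 * (-K) := by omega
        rw [this, zpow_add₀ (by norm_num), zpow_mul]
        simp only [zpow_natCast]
        norm_num
      rw [gammaStar, if_neg (by omega), hn, hp, inv_div, div_eq_mul_inv, mul_comm, ← inv_pow]
      norm_num
    have hji : j ∈ Finset.univ.erase i := Finset.mem_erase.mpr ⟨Ne.symm hij, Finset.mem_univ j⟩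
    have hpi : (l j : ℚ) * ∏ r ∈ Finset.univ.erase i, (gammaStar (l r + 1))⁻¹ =
        (∏ r ∈ Finset.univ.erase i, ((κ r).factorial : ℚ))⁻¹ := by
      rw [← Finset.prod_inv_distrib, ← Finset.mul_prod_erase _ _ hji,
        ← Finset.mul_prod_erase _ _ hji, ← mul_assoc]
      congr 1
      · have h1 : (l j).toNat = κ j + 1 := by
          have := hκ j (Ne.symm hij)
          simp [e] at this
          omega
        have h2 : (l j : ℚ) = (κ j : ℚ) + 1 := by
          have := hκ j (Ne.symm hij)
          simp [e] at this
          rw [this]; push_cast; ring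
        rw [hfac j (Ne.symm hij), h1, Nat.factorial_succ, h2]
        push_cast
        have : (κ j : ℚ) + 1 ≠ 0 := by positivity
        field_simp
      · refine Finset.prod_congr rfl fun r hr => ?_
        have hrj := Finset.ne_of_mem_erase hr
        have hr := Finset.ne_of_mem_erase (Finset.mem_of_mem_erase hr)
        rw [hfac r hr]
        simp [hκd, hr, e, hrj]
    have hne : ∏ r ∈ Finset.univ.erase i, ((κ r).factorial : ℚ) ≠ 0 :=
      Finset.prod_ne_zero_iff.mpr fun r _ => by positivity
    rw [if_pos ⟨hl, hl0⟩, ← Finset.mul_prod_erase _ _ (Finset.mem_univ i), mul_left_comm, hpi, hgi]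
    have hm := hprod κ
    rw [← hK] at hm
    push_cast
    rw [eq_div_of_mul_eq hne hm]
    field_simp

/-! ### The Newton polytope, open subsets and the matrices -/

/-- The Newton polytope `Δ` of `f`: the convex hull of its exponents. -/
def newtonPolytope {N n : ℕ} (a : Fin N ↪ (Fin n → ℤ)) : Set (Fin n → ℝ) :=
  convexHull ℝ (Set.range fun j => toReal (a j))

/-- `μ ⊆ Δ` is open if its complement `Δ \ μ` is a union of faces of `Δ` of any dimensions. -/
def IsOpenSubset {n : ℕ} (Δ μ : Set (Fin n → ℝ)) : Prop :=
  μ ⊆ Δ ∧ ∃ F : Set (Set (Fin n → ℝ)), (∀ A ∈ F, IsExposed ℝ Δ A) ∧ Δ \ μ = ⋃₀ F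

/-- `μ_ℤ`: the integral points in `μ`. -/
def integralPoints {n : ℕ} (μ : Set (Fin n → ℝ)) : Set (Fin n → ℤ) := {u | toReal u ∈ μ}

/-- The matrix `Ψ̃` with rows and columns indexed by the `j` with `a j ∈ μ`. -/
def PsiMatrix {N n : ℕ} (a : Fin N ↪ (Fin n → ℤ)) (μ : Set (Fin n → ℝ)) :
    Matrix {j // toReal (a j) ∈ μ} {j // toReal (a j) ∈ μ} (ConeSeries a) :=
  Matrix.of fun j i => PsiEntry a j i

/-- The matrix `ψ̃_m` with rows and columns indexed by the `j` with `a j ∈ μ`. -/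
def psiMatrix {N n : ℕ} (a : Fin N ↪ (Fin n → ℤ)) (μ : Set (Fin n → ℝ)) (m : ℕ) :
    Matrix {j // toReal (a j) ∈ μ} {j // toReal (a j) ∈ μ} (ConeSeries a) :=
  Matrix.of fun j i => psiEntry a m j i

/-- Congruence of matrices modulo the ideal of the coefficient ring generated by `q`. -/
def MatCongr {ι R : Type} [CommRing R] (q : ℕ) (A B : Matrix ι ι R) : Prop :=
  ∀ j i, (q : R) ∣ A j i - B j i

end AHypergeometric

end

open AHypergeometric

/-!
Write `y_r = v_r x^(a r)`, so that `f = ∑ r, y_r`. The degree in `x` of a monomial in the `y_r` is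
determined by its degree in `v` (`deg`), so the expansion at `a i` of a quotient of forms of the
same degree in the `y_r` is a formal series in the `y_r / y_i`, with exponents in the monoid
`expCone a i`. Families of such expansions, one for each `i` with `a i ∈ μ`, form an algebra
`Expansions a b` over `𝓡`, and taking constant terms is `𝓡`-linear. The matrix `Ψ̃` consists of
the constant terms of the *basic forms* `y_k / f`, and `ψ̃_m` of the constant terms of
`(1 - g ^ m) y_k / f` with `g = 1 - f / y_i`. All these matrices are the identity in weight `0`, hence
invertible (`matrix_isUnit_of_coeff_zero`).

The functional `w ↦ ct ((1 - g ^ m) w)` approximates `ct` in the following sense. Call `w`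
*derivative-like* if its coefficients in degrees divisible by `p ^ t` are divisible by `p ^ t`
(`derivLike`). Since `g ^ p` is congruent modulo `p` to the Frobenius transform of `g`, the
functional vanishes modulo `p ^ s` on derivative-like families when `p ^ s ∣ m`
(`dvd_ctFam_truncated_mul`). So if a rational function `w` is a combination `∑ c_k y_k / f` plus a
derivative-like family, then the same coefficients `c_k` express both the constant terms of `w`
through `Ψ̃` and, modulo `p ^ s`, its truncated constant terms through `ψ̃_m`.

That such combinations exist, for all rational functions whose numerators involve some `y_k` with
`a k ∈ μ`, is shown in `reduces`, by induction on the exponent `s`. The coefficients have to be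
`ct(w) Ψ̃⁻¹`, so one considers the projection `proj` which subtracts this combination of basic
forms. The Cartier operator, which keeps the terms of degree divisible by `p` (`cartier`),
preserves constant terms. With `f ^ p = f^σ - p G` it maps a rational function with denominator a
power of `f` to a series of rational functions with denominators powers of the Frobenius transform
`f^σ`; those of pole order one are combinations of the basic forms for `f^σ`, because all lattice
points of `μ` are among the exponents, and the others carry an additional factor `p`
(`reduces_cartier`).

The two congruences of the theorem are this principle applied to the image of `y_k / f` under the
Cartier operator (`truncMatrix_congr`) and to the derivative of `y_k / f`
(`truncMatrix_der_congr`).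

The Frobenius transforms `∑ r, y_r ^ q`, where `q` is a power of `p`, are kept as series in the
`y_r` themselves, with degrees divisible by `q`: instead of replacing `x ^ p` by `x` after an
application of the Cartier operator, the parameter `q` is carried along.
-/

open scoped BigOperators

noncomputable section

/-! ### Formal series over a monoid with finitely many decompositions -/

/-- The formal series `∑ b_l v^l` with integer coefficients, indexed by `M`. They form a ring under
convolution if every element of `M` is a sum of two elements in finitely many ways. -/
@[ext] structure FormalSeries (M : Type) where
  /-- The coefficients `b_l`. -/
  coeff : M → ℤ

/-- A grading of `M` by natural numbers for which only `0` has weight `0`. -/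
class PosWeight (M : Type) [AddCommMonoid M] where
  /-- The weight. -/
  wt : M →+ ℕ
  eq_zero_of_wt : ∀ x, wt x = 0 → x = 0

namespace FormalSeries

open Finset.HasAntidiagonal (antidiagonal mem_antidiagonal)

section Additive

variable {M : Type}

instance : Zero (FormalSeries M) := ⟨⟨fun _ => 0⟩⟩
instance : Add (FormalSeries M) := ⟨fun f g => ⟨fun l => f.coeff l + g.coeff l⟩⟩
instance : Neg (FormalSeries M) := ⟨fun f => ⟨fun l => -f.coeff l⟩⟩

theorem coeff_zero (l : M) : (0 : FormalSeries M).coeff l = 0 := rfl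

theorem coeff_add (f g : FormalSeries M) (l : M) :
    (f + g).coeff l = f.coeff l + g.coeff l := rfl

theorem coeff_neg (f : FormalSeries M) (l : M) : (-f).coeff l = -f.coeff l := rfl

open Classical in
/-- The monomial `v^x`. -/
def single (x : M) : FormalSeries M := ⟨fun l => if l = x then 1 else 0⟩

open Classical in
theorem coeff_single (x l : M) : (single x).coeff l = if l = x then 1 else 0 := rfl

end Additive

variable {M M' : Type} [AddCommMonoid M] [AddCommMonoid M']

open Classical in
instance : One (FormalSeries M) := ⟨⟨fun l => if l = 0 then 1 else 0⟩⟩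

open Classical in
theorem coeff_one (l : M) : (1 : FormalSeries M).coeff l = if l = 0 then 1 else 0 := rfl

theorem single_zero : single (0 : M) = 1 := rfl

variable [Finset.HasAntidiagonal M] [Finset.HasAntidiagonal M']

instance : Mul (FormalSeries M) :=
  ⟨fun f g => ⟨fun l => ∑ x ∈ antidiagonal l, f.coeff x.1 * g.coeff x.2⟩⟩

theorem coeff_mul (f g : FormalSeries M) (l : M) : (f * g).coeff l =
    ∑ x ∈ antidiagonal l, f.coeff x.1 * g.coeff x.2 := rfl

theorem mul_comm_aux (f g : FormalSeries M) : f * g = g * f := by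
  ext l
  rw [coeff_mul, coeff_mul]
  refine Finset.sum_nbij' Prod.swap Prod.swap ?_ ?_ ?_ ?_ ?_ <;>
    simp [add_comm, mul_comm]

theorem one_mul_aux (f : FormalSeries M) : 1 * f = f := by
  ext l
  rw [coeff_mul, Finset.sum_eq_single (0, l)]
  · simp [coeff_one]
  · rintro ⟨x, y⟩ hxy hne
    have hx : x ≠ 0 := by
      rintro rfl
      rw [mem_antidiagonal] at hxy
      simp only [zero_add] at hxy
      exact hne (by rw [hxy])
    simp [coeff_one, hx]
  · intro h
    exact absurd (mem_antidiagonal.mpr (zero_add l)) h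

theorem mul_assoc_aux (f g h : FormalSeries M) : f * g * h = f * (g * h) := by
  ext l
  simp only [coeff_mul, Finset.sum_mul, Finset.mul_sum, Finset.sum_sigma']
  apply Finset.sum_nbij' (fun ⟨⟨_i, j⟩, ⟨k, l⟩⟩ ↦ ⟨(k, l + j), (l, j)⟩)
    (fun ⟨⟨i, _j⟩, ⟨k, l⟩⟩ ↦ ⟨(i + k, l), (i, k)⟩) <;>
    simp only [Finset.mem_sigma, mem_antidiagonal, Sigma.forall, Prod.forall] <;>
    rintro x y z w ⟨h1, h2⟩ <;> subst h1 <;> subst h2 <;>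
    simp [add_assoc, mul_assoc]

theorem mul_add_aux (f g h : FormalSeries M) : f * (g + h) = f * g + f * h := by
  ext l
  simp only [coeff_mul, coeff_add, mul_add, Finset.sum_add_distrib]

instance : CommRing (FormalSeries M) where
  add_assoc f g h := by ext l; simp only [coeff_add, add_assoc]
  zero_add f := by ext l; simp only [coeff_add, coeff_zero, zero_add]
  add_zero f := by ext l; simp only [coeff_add, coeff_zero, add_zero]
  add_comm f g := by ext l; simp only [coeff_add, add_comm]
  neg_add_cancel f := by ext l; simp only [coeff_add, coeff_neg, coeff_zero, neg_add_cancel]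
  nsmul := nsmulRec
  zsmul := zsmulRec
  mul_assoc := mul_assoc_aux
  one_mul := one_mul_aux
  mul_one f := by rw [mul_comm_aux, one_mul_aux]
  mul_comm := mul_comm_aux
  left_distrib := mul_add_aux
  right_distrib f g h := by
    rw [mul_comm_aux, mul_add_aux, mul_comm_aux h f, mul_comm_aux h g]
  zero_mul f := by ext l; simp only [coeff_mul, coeff_zero, zero_mul, Finset.sum_const_zero]
  mul_zero f := by ext l; simp only [coeff_mul, coeff_zero, mul_zero, Finset.sum_const_zero]

/-- The coefficient of `v^l` as an additive map. -/
def coeffHom (l : M) : FormalSeries M →+ ℤ where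
  toFun f := f.coeff l
  map_zero' := rfl
  map_add' _ _ := rfl

theorem coeff_sub (f g : FormalSeries M) (l : M) : (f - g).coeff l = f.coeff l - g.coeff l :=
  map_sub (coeffHom l) f g

theorem coeff_sum {ι : Type*} (s : Finset ι) (f : ι → FormalSeries M) (l : M) :
    (∑ k ∈ s, f k).coeff l = ∑ k ∈ s, (f k).coeff l :=
  map_sum (coeffHom l) f s

theorem coeff_intCast_mul (q : ℤ) (f : FormalSeries M) (l : M) :
    ((q : FormalSeries M) * f).coeff l = q * f.coeff l := by
  rw [← zsmul_eq_mul]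
  exact (map_zsmul (coeffHom l) q f).trans (zsmul_eq_mul _ _)

theorem single_mul_single (x y : M) : single x * single y = single (x + y) := by
  classical
  ext l
  rw [coeff_mul, coeff_single]
  split_ifs with h
  · subst h
    rw [Finset.sum_eq_single (x, y)]
    · simp [coeff_single]
    · rintro ⟨x', y'⟩ - hne
      by_cases hx : x' = x
      · have hy : y' ≠ y := fun hy => hne (by rw [hx, hy])
        simp [coeff_single, hy]
      · simp [coeff_single, hx]
    · intro hn
      exact absurd (mem_antidiagonal.mpr rfl) hn
  · refine Finset.sum_eq_zero ?_
    rintro ⟨x', y'⟩ hxy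
    have hxy := mem_antidiagonal.mp hxy
    by_cases hx : x' = x
    · have hy : y' ≠ y := by rintro rfl; subst hx; exact h hxy.symm
      simp [coeff_single, hy]
    · simp [coeff_single, hx]

theorem single_pow (x : M) (k : ℕ) : single x ^ k = single (k • x) := by
  induction k with
  | zero => rw [pow_zero, zero_smul, single_zero]
  | succ k ih => rw [pow_succ, ih, single_mul_single, succ_nsmul]

theorem prod_single {ι : Type*} (s : Finset ι) (x : ι → M) :
    ∏ r ∈ s, single (x r) = single (∑ r ∈ s, x r) := by
  classical
  induction s using Finset.induction_on with
  | empty => rw [Finset.prod_empty, Finset.sum_empty, single_zero]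
  | insert r s hr ih => rw [Finset.prod_insert hr, Finset.sum_insert hr, ih, single_mul_single]

/-- Transport of series along an injective map of monoids: `∑ b_l v^l ↦ ∑ b_l v^(j l)`. -/
def map (j : M →+ M') (hj : Function.Injective j) :
    FormalSeries M →+* FormalSeries M' where
  toFun f := ⟨Function.extend j f.coeff 0⟩
  map_zero' := by
    ext l
    by_cases h : ∃ k, j k = l
    · obtain ⟨k, rfl⟩ := h
      simp [hj.extend_apply, coeff_zero]
    · simp [Function.extend_apply' _ _ _ h, coeff_zero]
  map_one' := by
    ext l
    by_cases h : ∃ k, j k = l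
    · obtain ⟨k, rfl⟩ := h
      refine (hj.extend_apply _ _ _).trans ?_
      by_cases hk : k = 0
      · simp [coeff_one, hk]
      · have : j k ≠ 0 := fun h => hk (hj (h.trans (map_zero j).symm))
        simp [coeff_one, hk, this]
    · have : l ≠ 0 := by rintro rfl; exact h ⟨0, map_zero j⟩
      simp [Function.extend_apply' _ _ _ h, coeff_one, this]
  map_add' f g := by
    ext l
    by_cases h : ∃ k, j k = l
    · obtain ⟨k, rfl⟩ := h
      simp [hj.extend_apply, coeff_add]
    · simp [Function.extend_apply' _ _ _ h, coeff_add]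
  map_mul' f g := by
    ext l
    rw [coeff_mul]
    by_cases h : ∃ k, j k = l
    · obtain ⟨k, rfl⟩ := h
      simp only [hj.extend_apply, coeff_mul]
      refine Finset.sum_of_injOn (fun x => (j x.1, j x.2)) ?_ ?_ ?_ ?_
      · rintro ⟨x, y⟩ _ ⟨x', y'⟩ _ hxy
        simp only [Prod.mk.injEq] at hxy
        exact Prod.ext (hj hxy.1) (hj hxy.2)
      · rintro ⟨x, y⟩ hxy
        simp only [Finset.mem_coe, mem_antidiagonal] at hxy ⊢
        rw [← map_add, hxy]
      · rintro ⟨x, y⟩ hxy hn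
        by_cases hx : ∃ x', j x' = x
        · by_cases hy : ∃ y', j y' = y
          · obtain ⟨x', rfl⟩ := hx
            obtain ⟨y', rfl⟩ := hy
            refine absurd ⟨(x', y'), ?_, rfl⟩ hn
            simp only [Finset.mem_coe, mem_antidiagonal] at hxy ⊢
            exact hj (by rw [map_add, hxy])
          · simp [Function.extend_apply' _ _ _ hy]
        · simp [Function.extend_apply' _ _ _ hx]
      · rintro ⟨x, y⟩ _
        simp only [hj.extend_apply]
    · refine Eq.trans (Function.extend_apply' _ _ _ h) (Finset.sum_eq_zero ?_).symm
      rintro ⟨x, y⟩ hxy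
      by_cases hx : ∃ x', j x' = x
      · by_cases hy : ∃ y', j y' = y
        · obtain ⟨x', rfl⟩ := hx
          obtain ⟨y', rfl⟩ := hy
          exact absurd ⟨x' + y', by rw [map_add]; exact mem_antidiagonal.mp hxy⟩ h
        · simp [Function.extend_apply' _ _ _ hy]
      · simp [Function.extend_apply' _ _ _ hx]

theorem map_coeff (j : M →+ M') (hj : Function.Injective j) (f : FormalSeries M) (k : M) :
    (map j hj f).coeff (j k) = f.coeff k := hj.extend_apply _ _ _

theorem map_coeff_of_not (j : M →+ M') (hj : Function.Injective j) (f : FormalSeries M) (l : M')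
    (h : ¬ ∃ k, j k = l) : (map j hj f).coeff l = 0 := Function.extend_apply' _ _ _ h

theorem map_single (j : M →+ M') (hj : Function.Injective j) (x : M) :
    map j hj (single x) = single (j x) := by
  classical
  ext l
  by_cases h : ∃ k, j k = l
  · obtain ⟨k, rfl⟩ := h
    rw [map_coeff, coeff_single, coeff_single, hj.eq_iff]
  · rw [map_coeff_of_not _ _ _ _ h, coeff_single, if_neg]
    rintro rfl
    exact h ⟨x, rfl⟩

/-- The derivation `∑ b_l v^l ↦ ∑ D(l) b_l v^l` attached to an additive function `D`. -/
def der (D : M →+ ℤ) : Derivation ℤ (FormalSeries M) (FormalSeries M) :=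
  Derivation.mk'
    (AddMonoidHom.toIntLinearMap
      { toFun := fun b => ⟨fun l => D l * b.coeff l⟩
        map_zero' := by ext l; simp [coeff_zero]
        map_add' := fun f g => by ext l; simp [coeff_add, mul_add] })
    (by
      intro f g
      ext l
      simp only [AddMonoidHom.coe_toIntLinearMap, AddMonoidHom.coe_mk, ZeroHom.coe_mk,
        smul_eq_mul, coeff_add]
      rw [mul_comm g]
      simp only [coeff_mul, Finset.mul_sum, ← Finset.sum_add_distrib]
      refine Finset.sum_congr rfl fun x hx => ?_
      rw [← mem_antidiagonal.mp hx, map_add]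
      ring)

theorem der_coeff (D : M →+ ℤ) (f : FormalSeries M) (l : M) :
    (der D f).coeff l = D l * f.coeff l := rfl

theorem der_single (D : M →+ ℤ) (x : M) : der D (single x) = (D x : FormalSeries M) * single x := by
  classical
  ext l
  rw [der_coeff, coeff_intCast_mul, coeff_single]
  split_ifs with h
  · rw [h]
  · simp

open Classical in
/-- The part of a series supported in `H`. -/
def restrict (H : Set M) : FormalSeries M →+ FormalSeries M where
  toFun f := ⟨fun l => if l ∈ H then f.coeff l else 0⟩
  map_zero' := by ext l; simp [coeff_zero]
  map_add' f g := by ext l; simp only [coeff_add]; split_ifs <;> simp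

open Classical in
theorem restrict_coeff (H : Set M) (f : FormalSeries M) (l : M) :
    (restrict H f).coeff l = if l ∈ H then f.coeff l else 0 := rfl

theorem restrict_mul {H : Set M} (hH : ∀ x ∈ H, ∀ y, x + y ∈ H ↔ y ∈ H) {f : FormalSeries M}
    (hf : restrict H f = f) (g : FormalSeries M) : restrict H (f * g) = f * restrict H g := by
  classical
  ext l
  have h1 : ∀ x ∈ antidiagonal l, f.coeff x.1 * (restrict H g).coeff x.2 =
      f.coeff x.1 * if l ∈ H then g.coeff x.2 else 0 := by
    intro x hx
    by_cases hx1 : x.1 ∈ H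
    · rw [restrict_coeff, ← mem_antidiagonal.mp hx]
      simp only [hH _ hx1]
    · rw [← hf, restrict_coeff, if_neg hx1, zero_mul, zero_mul]
  rw [restrict_coeff, coeff_mul, coeff_mul, Finset.sum_congr rfl h1]
  split_ifs <;> simp

/-! ### The filtration by weight and units -/

variable [PosWeight M]

/-- The ideal of the series all of whose terms have weight at least `Q`. -/
def high (M : Type) [AddCommMonoid M] [Finset.HasAntidiagonal M] [PosWeight M] (Q : ℕ) :
    Ideal (FormalSeries M) where
  carrier := {f | ∀ l, PosWeight.wt l < Q → f.coeff l = 0}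
  zero_mem' _ _ := rfl
  add_mem' hf hg l hl := by rw [coeff_add, hf l hl, hg l hl, add_zero]
  smul_mem' c f hf l hl := by
    rw [smul_eq_mul, coeff_mul]
    refine Finset.sum_eq_zero fun x hx => ?_
    rw [hf x.2, mul_zero]
    rw [← mem_antidiagonal.mp hx, map_add] at hl
    omega

theorem mem_high_one {f : FormalSeries M} : f ∈ high M 1 ↔ f.coeff 0 = 0 := by
  refine ⟨fun h => h 0 (by simp), fun h l hl => ?_⟩
  rwa [PosWeight.eq_zero_of_wt l (by omega)]

theorem mul_mem_high {P Q : ℕ} {f g : FormalSeries M} (hf : f ∈ high M P) (hg : g ∈ high M Q) :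
    f * g ∈ high M (P + Q) := by
  intro l hl
  rw [coeff_mul]
  refine Finset.sum_eq_zero fun x hx => ?_
  rw [← mem_antidiagonal.mp hx, map_add] at hl
  by_cases h : PosWeight.wt x.1 < P
  · rw [hf _ h, zero_mul]
  · rw [hg _ (by omega), mul_zero]

theorem pow_mem_high {f : FormalSeries M} (hf : f ∈ high M 1) (k : ℕ) : f ^ k ∈ high M k := by
  induction k with
  | zero => intro l hl; omega
  | succ k ih => rw [pow_succ]; exact mul_mem_high ih hf

/-- The constant coefficient is multiplicative, because `0` is the only element of weight `0`. -/
def constCoeff (M : Type) [AddCommMonoid M] [Finset.HasAntidiagonal M] [PosWeight M] :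
    FormalSeries M →+* ℤ where
  toFun f := f.coeff 0
  map_zero' := rfl
  map_one' := by simp [coeff_one]
  map_add' _ _ := rfl
  map_mul' f g := by
    rw [coeff_mul, Finset.sum_eq_single (0, 0)]
    · rintro ⟨x, y⟩ hxy hne
      have h : PosWeight.wt x + PosWeight.wt y = 0 := by
        rw [← map_add, mem_antidiagonal.mp hxy, map_zero]
      refine absurd ?_ hne
      rw [PosWeight.eq_zero_of_wt x (by omega), PosWeight.eq_zero_of_wt y (by omega)]
    · intro h
      exact absurd (mem_antidiagonal.mpr (zero_add 0)) h

/-- The geometric series `∑ k, g ^ k`, for `g` without constant term. -/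
def geom (g : FormalSeries M) : FormalSeries M :=
  ⟨fun l => (∑ k ∈ Finset.range (PosWeight.wt l + 1), g ^ k).coeff l⟩

theorem sub_geom_sum_mem_high {g : FormalSeries M} (hg : g ∈ high M 1) (K : ℕ) :
    geom g - ∑ k ∈ Finset.range K, g ^ k ∈ high M K := by
  intro l hl
  rw [coeff_sub, geom, sub_eq_zero, coeff_sum, coeff_sum]
  refine Finset.sum_subset (Finset.range_mono hl) fun k _ hk => ?_
  exact pow_mem_high hg k l (by simpa using hk)

theorem one_sub_mul_geom {g : FormalSeries M} (hg : g ∈ high M 1) : (1 - g) * geom g = 1 := by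
  ext l
  set K := PosWeight.wt l + 1 with hK
  have h1 : (1 - g) * geom g - 1 =
      (1 - g) * (geom g - ∑ k ∈ Finset.range K, g ^ k) - g ^ K := by
    rw [mul_sub, mul_neg_geom_sum]
    ring
  have h2 : (1 - g) * geom g - 1 ∈ high M K := by
    rw [h1]
    exact sub_mem (Ideal.mul_mem_left _ _ (sub_geom_sum_mem_high hg K)) (pow_mem_high hg K)
  have := h2 l (by omega)
  rwa [coeff_sub, sub_eq_zero] at this

theorem isUnit_of_coeff_zero {f : FormalSeries M} (hf : f.coeff 0 = 1) : IsUnit f := by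
  have h : 1 - f ∈ high M 1 := mem_high_one.mpr (by rw [coeff_sub, hf]; simp [coeff_one])
  have := one_sub_mul_geom h
  rw [sub_sub_cancel] at this
  exact IsUnit.of_mul_eq_one _ this

end FormalSeries

namespace AHypergeometric

open scoped Matrix
open Finset.HasAntidiagonal (antidiagonal mem_antidiagonal)

section

variable {N n : ℕ} (a : Fin N ↪ (Fin n → ℤ))

/-! ### The cones of exponents of the expansions at the vertices -/

/-- The degree of the monomial `v^l x^u` in `x` when `v^l x^u` is a monomial in the
`v_r x^(a r)`: it is determined by `l`. -/
def deg : (Fin N → ℤ) →+ (Fin n → ℤ) where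
  toFun l := ∑ r, l r • a r
  map_zero' := by simp
  map_add' l l' := by simp [add_smul, Finset.sum_add_distrib]

/-- The linear form `l ↦ ∑ r, l r * |a r - a i|²`. -/
def localWeight (i : Fin N) : (Fin N → ℤ) →+ ℤ where
  toFun l := ∑ r, l r * ∑ d, (a r d - a i d) ^ 2
  map_zero' := by simp
  map_add' l l' := by simp [add_mul, Finset.sum_add_distrib]

/-- The cone generated by the differences `e r - e i`: the exponents of the monomials in the
`v_r x^(a r) / (v_i x^(a i))`. -/
def vertexCone (i : Fin N) : AddSubmonoid (Fin N → ℤ) where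
  carrier := {l | ∑ r, l r = 0 ∧ ∀ r, r ≠ i → 0 ≤ l r}
  zero_mem' := by simp
  add_mem' := by
    rintro x y ⟨hx, hx'⟩ ⟨hy, hy'⟩
    refine ⟨by simp [Finset.sum_add_distrib, hx, hy], fun r hr => ?_⟩
    exact add_nonneg (hx' r hr) (hy' r hr)

/-- The exponents of the series which occur in expansions at `a i` with coefficients in `𝓡`. -/
def expCone (i : Fin N) : AddSubmonoid (Fin N → ℤ) := latticeCone a ⊔ vertexCone i

variable {a}

theorem sum_zero_of_mem_latticeCone {l : Fin N → ℤ} (hl : l ∈ latticeCone a) :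
    ∑ r, l r = 0 ∧ deg a l = 0 := by
  let K : PointedCone ℝ (Fin N → ℝ) :=
    { carrier := {x | ∑ r, x r = 0 ∧ ∀ d, ∑ r, x r * (a r d : ℝ) = 0}
      zero_mem' := by simp
      add_mem' := by
        rintro x y ⟨hx, hx'⟩ ⟨hy, hy'⟩
        refine ⟨by simp [Finset.sum_add_distrib, hx, hy], fun d => ?_⟩
        simp [add_mul, Finset.sum_add_distrib, hx' d, hy' d]
      smul_mem' := by
        rintro ⟨c, hc⟩ x ⟨hx, hx'⟩
        simp only [Nonneg.mk_smul, Set.mem_ofPred_eq, Pi.smul_apply, smul_eq_mul, mul_assoc,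
          ← Finset.mul_sum, hx, hx', mul_zero, implies_true, and_self] }
  have hK : realCone a ≤ K := by
    refine iSup_le fun i => Submodule.span_le.mpr ?_
    rintro _ ⟨l, hl, rfl⟩
    obtain ⟨h0, h1⟩ := (sum_homog_eq_zero_iff a l).mp hl.1
    refine ⟨by simp only [toReal]; exact_mod_cast h0, fun d => ?_⟩
    have := congrFun h1 d
    simp only [Finset.sum_apply, Pi.smul_apply, smul_eq_mul, Pi.zero_apply] at this
    simp only [toReal]
    exact_mod_cast this
  obtain ⟨h0, h1⟩ := hK hl
  refine ⟨by simp only [toReal] at h0; exact_mod_cast h0, funext fun d => ?_⟩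
  have := h1 d
  simp only [toReal] at this
  simp only [deg, AddMonoidHom.coe_mk, ZeroHom.coe_mk, Finset.sum_apply, Pi.smul_apply,
    smul_eq_mul, Pi.zero_apply]
  exact_mod_cast this

theorem mem_latticeCone_of_nonneg {l : Fin N → ℤ} (i : Fin N) (h0 : ∑ r, l r = 0)
    (h1 : deg a l = 0) (hl : ∀ r, r ≠ i → 0 ≤ l r) : l ∈ latticeCone a :=
  relations_subset_latticeCone a i ⟨(sum_homog_eq_zero_iff a l).mpr ⟨h0, h1⟩, hl⟩

/-- The exponents of degree `0` in `x` of the expansions at `a i` lie in `L°`: this is why constant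
terms have values in `𝓡`, and are `𝓡`-linear. -/
theorem mem_latticeCone_of_deg {i : Fin N} {l : Fin N → ℤ} (hl : l ∈ expCone a i)
    (h : deg a l = 0) : l ∈ latticeCone a := by
  obtain ⟨x, hx, y, hy, rfl⟩ := AddSubmonoid.mem_sup.mp hl
  rw [map_add, (sum_zero_of_mem_latticeCone hx).2, zero_add] at h
  exact add_mem hx (mem_latticeCone_of_nonneg i hy.1 h hy.2)

theorem localWeight_eq_of_mem {l : Fin N → ℤ} (hl : l ∈ latticeCone a) (i : Fin N) :
    localWeight a i l = ∑ r, l r * ∑ d, (a r d) ^ 2 := by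
  obtain ⟨h0, h1⟩ := sum_zero_of_mem_latticeCone hl
  have h1 : ∀ d, ∑ r, l r * a r d = 0 := fun d => by
    simpa [deg, Finset.sum_apply] using congrFun h1 d
  have e : ∀ r, l r * ∑ d, (a r d - a i d) ^ 2 = l r * (∑ d, (a r d) ^ 2)
      - 2 * ∑ d, a i d * (l r * a r d) + l r * ∑ d, (a i d) ^ 2 := by
    intro r
    simp only [Finset.mul_sum, ← Finset.sum_sub_distrib, ← Finset.sum_add_distrib]
    exact Finset.sum_congr rfl fun d _ => by ring
  simp only [localWeight, AddMonoidHom.coe_mk, ZeroHom.coe_mk, e, Finset.sum_add_distrib,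
    Finset.sum_sub_distrib, ← Finset.mul_sum, ← Finset.sum_mul, h0]
  rw [Finset.sum_comm]
  simp only [← Finset.mul_sum, h1]
  simp

theorem abs_le_of_mem_latticeCone {l : Fin N → ℤ} (hl : l ∈ latticeCone a) (r : Fin N) :
    |l r| ≤ ∑ r, l r * ∑ d, (a r d) ^ 2 := by
  have := abs_le_weight a hl r
  simp only [toReal, weight] at this
  exact_mod_cast this

theorem abs_le_of_mem_vertexCone {i : Fin N} {l : Fin N → ℤ} (hl : l ∈ vertexCone i)
    (r : Fin N) : |l r| ≤ localWeight a i l := by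
  obtain ⟨h0, hp⟩ := hl
  have hd : ∀ r, r ≠ i → 1 ≤ ∑ d, (a r d - a i d) ^ 2 := by
    intro r hr
    obtain ⟨d, hd⟩ : ∃ d, a r d ≠ a i d := by
      by_contra hc
      push Not at hc
      exact hr (a.injective (funext hc))
    have h1 : (a r d - a i d) ^ 2 ≤ ∑ d, (a r d - a i d) ^ 2 :=
      Finset.single_le_sum (f := fun d => (a r d - a i d) ^ 2) (fun _ _ => sq_nonneg _)
        (Finset.mem_univ d)
    have h2 : 0 < (a r d - a i d) ^ 2 := by
      have := sub_ne_zero.mpr hd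
      positivity
    omega
  have hle : ∑ r ∈ Finset.univ.erase i, l r ≤ localWeight a i l := by
    simp only [localWeight, AddMonoidHom.coe_mk, ZeroHom.coe_mk]
    rw [← Finset.add_sum_erase Finset.univ _ (Finset.mem_univ i)]
    simp only [sub_self, ne_eq, OfNat.ofNat_ne_zero, not_false_eq_true, zero_pow,
      Finset.sum_const_zero, mul_zero, zero_add]
    refine Finset.sum_le_sum fun r hr => ?_
    have hr := Finset.ne_of_mem_erase hr
    nlinarith [hp r hr, hd r hr]
  have hi : l i = -∑ r ∈ Finset.univ.erase i, l r := by
    rw [← Finset.add_sum_erase Finset.univ _ (Finset.mem_univ i)] at h0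
    omega
  refine le_trans ?_ hle
  by_cases hr : r = i
  · rw [hr, hi, abs_neg, abs_of_nonneg]
    exact Finset.sum_nonneg fun r hr => hp r (Finset.ne_of_mem_erase hr)
  · rw [abs_of_nonneg (hp r hr)]
    exact Finset.single_le_sum (f := l) (fun r hr => hp r (Finset.ne_of_mem_erase hr))
      (Finset.mem_erase.mpr ⟨hr, Finset.mem_univ r⟩)

theorem abs_le_of_mem_expCone {i : Fin N} {l : Fin N → ℤ} (hl : l ∈ expCone a i) (r : Fin N) :
    |l r| ≤ localWeight a i l := by
  obtain ⟨x, hx, y, hy, rfl⟩ := AddSubmonoid.mem_sup.mp hl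
  rw [map_add, localWeight_eq_of_mem hx]
  exact (abs_add_le _ _).trans
    (add_le_add (abs_le_of_mem_latticeCone hx r) (abs_le_of_mem_vertexCone hy r))

theorem localWeight_nonneg {i : Fin N} {l : Fin N → ℤ} (hl : l ∈ expCone a i) :
    0 ≤ localWeight a i l := (abs_nonneg _).trans (abs_le_of_mem_expCone hl i)

theorem expCone_finite_decompositions (i : Fin N) (k : expCone a i) :
    {x : expCone a i × expCone a i | x.1 + x.2 = k}.Finite := by
  set B := localWeight a i k
  let box : Set (Fin N → ℤ) := Set.Icc (fun _ => -B) (fun _ => B)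
  have hbox : (box ×ˢ box).Finite := (Set.finite_Icc _ _).prod (Set.finite_Icc _ _)
  refine Set.Finite.of_finite_image (f := fun x => (x.1.1, x.2.1)) (hbox.subset ?_) ?_
  · rintro _ ⟨⟨x, y⟩, hxy, rfl⟩
    have hw : B = localWeight a i x + localWeight a i y := by
      rw [← map_add, ← AddSubmonoid.coe_add, show x + y = k from hxy]
    have hx := localWeight_nonneg x.2
    have hy := localWeight_nonneg y.2
    have h1 : ∀ r, |x.1 r| ≤ B := fun r => (abs_le_of_mem_expCone x.2 r).trans (by omega)
    have h2 : ∀ r, |y.1 r| ≤ B := fun r => (abs_le_of_mem_expCone y.2 r).trans (by omega)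
    exact ⟨⟨fun r => (abs_le.mp (h1 r)).1, fun r => (abs_le.mp (h1 r)).2⟩,
      ⟨fun r => (abs_le.mp (h2 r)).1, fun r => (abs_le.mp (h2 r)).2⟩⟩
  · rintro ⟨x, y⟩ _ ⟨x', y'⟩ _ h
    simp only [Prod.mk.injEq] at h
    exact Prod.ext (Subtype.ext h.1) (Subtype.ext h.2)

instance (i : Fin N) : Finset.HasAntidiagonal (expCone a i) where
  antidiagonal k := (expCone_finite_decompositions i k).toFinset
  mem_antidiagonal := by simp

instance (i : Fin N) : PosWeight (expCone a i) where
  wt :=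
    { toFun := fun l => (localWeight a i l).toNat
      map_zero' := by simp
      map_add' := fun x y => by
        rw [AddSubmonoid.coe_add, map_add,
          Int.toNat_add (localWeight_nonneg x.2) (localWeight_nonneg y.2)] }
  eq_zero_of_wt x hx := by
    have h0 : localWeight a i x = 0 :=
      le_antisymm (Int.toNat_eq_zero.mp hx) (localWeight_nonneg x.2)
    refine Subtype.ext (funext fun r => ?_)
    simpa [h0] using abs_le_of_mem_expCone x.2 r

theorem wt_expCone {i : Fin N} (l : expCone a i) :
    PosWeight.wt l = (localWeight a i l).toNat := rfl

instance : PosWeight (latticeCone a) where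
  wt :=
    { toFun := fun l => (∑ r, (l : Fin N → ℤ) r * ∑ d, (a r d) ^ 2).toNat
      map_zero' := by simp
      map_add' := fun x y => by
        simp only [AddSubmonoid.coe_add, Pi.add_apply, add_mul, Finset.sum_add_distrib]
        by_cases hN : Nonempty (Fin N)
        · obtain ⟨r⟩ := hN
          rw [Int.toNat_add ((abs_nonneg _).trans (abs_le_of_mem_latticeCone x.2 r))
            ((abs_nonneg _).trans (abs_le_of_mem_latticeCone y.2 r))]
        · rw [not_nonempty_iff] at hN
          simp }
  eq_zero_of_wt x hx := by
    refine Subtype.ext (funext fun r => ?_)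
    have h := abs_le_of_mem_latticeCone x.2 r
    have h2 := Int.toNat_eq_zero.mp hx
    have h3 := abs_nonneg ((x : Fin N → ℤ) r)
    exact abs_eq_zero.mp (by omega)

theorem wt_latticeCone (l : latticeCone a) :
    PosWeight.wt l = (∑ r, (l : Fin N → ℤ) r * ∑ d, (a r d) ^ 2).toNat := rfl

/-- The inclusion of `L°` into the exponents of expansions at `a i`. -/
def inclCone (i : Fin N) : latticeCone a →+ expCone a i := AddSubmonoid.inclusion le_sup_left

theorem inclCone_injective (i : Fin N) : Function.Injective (inclCone (a := a) i) :=
  AddSubmonoid.inclusion_injective le_sup_left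

theorem coe_inclCone (i : Fin N) (l : latticeCone a) : (inclCone i l : Fin N → ℤ) = l := rfl

theorem wt_inclCone (i : Fin N) (l : latticeCone a) :
    PosWeight.wt (inclCone i l) = PosWeight.wt l := by
  rw [wt_expCone, wt_latticeCone, coe_inclCone, localWeight_eq_of_mem l.2]

/-! ### The rings of expansions and the constant term -/

/-- The ring `𝓡`, as a ring of formal series. -/
def seriesEquiv : ConeSeries a ≃+* FormalSeries (latticeCone a) where
  toFun b := ⟨b.coeff⟩
  invFun b := ⟨b.coeff⟩
  left_inv _ := rfl
  right_inv _ := rfl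
  map_mul' _ _ := rfl
  map_add' _ _ := rfl

theorem seriesEquiv_coeff (b : ConeSeries a) (l : latticeCone a) :
    (seriesEquiv b).coeff l = b.coeff l := rfl

variable (a) in
/-- The ring of expansions at `a i`. -/
abbrev Expansion (i : Fin N) : Type := FormalSeries (expCone a i)

/-- An element of `𝓡` as a constant in the ring of expansions at `a i`. -/
def const (i : Fin N) : ConeSeries a →+* Expansion a i :=
  (FormalSeries.map (inclCone i) (inclCone_injective i)).comp seriesEquiv.toRingHom

theorem const_coeff (i : Fin N) (b : ConeSeries a) (l : latticeCone a) :
    (const i b).coeff (inclCone i l) = b.coeff l :=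
  FormalSeries.map_coeff _ (inclCone_injective i) _ _

theorem const_coeff_of_deg (i : Fin N) (b : ConeSeries a) (l : expCone a i)
    (hl : deg a l ≠ 0) : (const i b).coeff l = 0 := by
  refine FormalSeries.map_coeff_of_not _ (inclCone_injective i) _ _ ?_
  rintro ⟨k, rfl⟩
  exact hl (sum_zero_of_mem_latticeCone k.2).2

/-- The constant term in `x` of an expansion at `a i`. -/
def ct (i : Fin N) : Expansion a i →+ ConeSeries a where
  toFun f := ⟨fun l => f.coeff (inclCone i l)⟩
  map_zero' := rfl
  map_add' _ _ := rfl

theorem ct_coeff (i : Fin N) (f : Expansion a i) (l : latticeCone a) :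
    (ct i f).coeff l = f.coeff (inclCone i l) := rfl

theorem exists_inclCone {i : Fin N} {l : expCone a i} (h : deg a l = 0) :
    ∃ k : latticeCone a, inclCone i k = l :=
  ⟨⟨l, mem_latticeCone_of_deg l.2 h⟩, rfl⟩

theorem ct_const_mul (i : Fin N) (b : ConeSeries a) (f : Expansion a i) :
    ct i (const i b * f) = b * ct i f := by
  ext l
  rw [ct_coeff, FormalSeries.coeff_mul, ConeSeries.coeff_mul]
  symm
  refine Finset.sum_of_injOn (fun x => (inclCone i x.1, inclCone i x.2)) ?_ ?_ ?_ ?_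
  · rintro ⟨x, y⟩ _ ⟨x', y'⟩ _ hxy
    simp only [Prod.mk.injEq] at hxy
    exact Prod.ext (inclCone_injective i hxy.1) (inclCone_injective i hxy.2)
  · rintro ⟨x, y⟩ hxy
    simp only [Finset.mem_coe, mem_antidiagonal] at hxy ⊢
    rw [← map_add, hxy]
  · rintro ⟨x, y⟩ hxy hn
    by_cases hx : deg a x = 0
    · have hy : deg a y = 0 := by
        have h := congrArg (fun z : expCone a i => deg a z) (mem_antidiagonal.mp hxy)
        simp only [AddSubmonoid.coe_add, map_add, hx, zero_add, coe_inclCone] at h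
        rw [h, (sum_zero_of_mem_latticeCone l.2).2]
      obtain ⟨x', rfl⟩ := exists_inclCone hx
      obtain ⟨y', rfl⟩ := exists_inclCone hy
      refine absurd ⟨(x', y'), ?_, rfl⟩ hn
      simp only [Finset.mem_coe, mem_antidiagonal] at hxy ⊢
      exact inclCone_injective i (by rw [map_add, hxy])
    · simp only [const_coeff_of_deg i b x hx, zero_mul]
  · rintro ⟨x, y⟩ _
    simp only [const_coeff, ct_coeff]

end

section

variable {N n : ℕ} {a : Fin N ↪ (Fin n → ℤ)} {J : Type} {b : J → Fin N}

/-! ### Families of expansions -/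

variable (a b) in
/-- Families of expansions, one at each of the points `a (b i)`. -/
abbrev Expansions : Type := ∀ i : J, Expansion a (b i)

variable (b) in
/-- An element of `𝓡` as a constant family. -/
def constFam : ConeSeries a →+* Expansions a b := RingHom.pi fun i => const (b i)

theorem constFam_apply (c : ConeSeries a) (i : J) : constFam b c i = const (b i) c := rfl

/-- The constant terms of a family of expansions. -/
def ctFam : Expansions a b →+ (J → ConeSeries a) where
  toFun w i := ct (b i) (w i)
  map_zero' := by ext1 i; simp
  map_add' _ _ := by ext1 i; simp

theorem ctFam_apply (w : Expansions a b) (i : J) : ctFam w i = ct (b i) (w i) := rfl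

theorem ctFam_constFam_mul (c : ConeSeries a) (w : Expansions a b) :
    ctFam (constFam b c * w) = c • ctFam w := by
  ext1 i
  simp [ctFam_apply, constFam_apply, ct_const_mul]

/-- The exponents whose degree in `x` is divisible by `q`. -/
def degDvd (q : ℕ) (i : Fin N) : Set (expCone a i) := {l | ∀ d, (q : ℤ) ∣ deg a l d}

/-- The part of a family of expansions with degrees in `x` divisible by `q`. After the substitution
of `x` for `x ^ q` this is the Cartier operator. -/
def cartier (q : ℕ) : Expansions a b →+ Expansions a b where
  toFun w i := FormalSeries.restrict (degDvd q (b i)) (w i)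
  map_zero' := by ext1 i; simp
  map_add' _ _ := by ext1 i; simp

theorem cartier_apply (q : ℕ) (w : Expansions a b) (i : J) :
    cartier q w i = FormalSeries.restrict (degDvd q (b i)) (w i) := rfl

theorem cartier_mul {q : ℕ} {w : Expansions a b} (hw : cartier q w = w) (w' : Expansions a b) :
    cartier q (w * w') = w * cartier q w' := by
  ext1 i
  refine FormalSeries.restrict_mul ?_ (congrFun hw i) (w' i)
  intro x hx y
  refine forall_congr' fun d => ?_
  rw [AddSubmonoid.coe_add, map_add, Pi.add_apply]
  exact dvd_add_right (hx d)

theorem ctFam_cartier (q : ℕ) (w : Expansions a b) : ctFam (cartier q w) = ctFam w := by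
  ext i l
  rw [ctFam_apply, ctFam_apply, ct_coeff, ct_coeff, cartier_apply, FormalSeries.restrict_coeff,
    if_pos]
  intro d
  rw [coe_inclCone, (sum_zero_of_mem_latticeCone l.2).2]
  simp

variable (a b) in
/-- The families of expansions all of whose terms have degree in `x` divisible by `q`. -/
def cartierFixed (q : ℕ) : Subring (Expansions a b) where
  carrier := {w | cartier q w = w}
  mul_mem' {w w'} hw hw' := by
    change cartier q (w * w') = _
    rw [cartier_mul hw, show cartier q w' = w' from hw']
  one_mem' := by
    classical
    change cartier q 1 = 1
    ext i l
    rw [cartier_apply, FormalSeries.restrict_coeff, Pi.one_apply, FormalSeries.coeff_one]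
    by_cases hl : l = 0
    · subst hl
      rw [if_pos]
      intro d
      simp
    · simp [hl]
  add_mem' {w w'} hw hw' := by
    change cartier q (w + w') = _
    rw [map_add, show cartier q w = w from hw, show cartier q w' = w' from hw']
  zero_mem' := map_zero _
  neg_mem' {w} hw := by
    change cartier q (-w) = _
    rw [map_neg, show cartier q w = w from hw]

theorem mem_cartierFixed {q : ℕ} {w : Expansions a b} :
    w ∈ cartierFixed a b q ↔ cartier q w = w := Iff.rfl

theorem constFam_mem_cartierFixed (q : ℕ) (c : ConeSeries a) :
    constFam b c ∈ cartierFixed a b q := by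
  classical
  change cartier q _ = _
  ext i l
  rw [cartier_apply, FormalSeries.restrict_coeff]
  by_cases hl : deg a l = 0
  · rw [if_pos]
    intro d
    simp [hl]
  · rw [constFam_apply, const_coeff_of_deg _ _ _ hl, ite_self]

/-! ### The monomials and the powers of the generic polynomial -/

theorem sub_mem_expCone (r i : Fin N) : (e r - e i : Fin N → ℤ) ∈ expCone a i := by
  refine (le_sup_right : vertexCone i ≤ _) ⟨by simp [e], fun s hs => ?_⟩
  simp only [e, Pi.sub_apply, Pi.single_apply, if_neg hs, sub_zero]
  split_ifs <;> simp

variable (a) in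
/-- The exponent of the monomial `v_r x^(a r) / (v_i x^(a i))`. -/
def ratioExp (i r : Fin N) : expCone a i := ⟨e r - e i, sub_mem_expCone r i⟩

theorem coe_ratioExp (i r : Fin N) : (ratioExp a i r : Fin N → ℤ) = e r - e i := rfl

theorem ratioExp_eq_zero_iff (i r : Fin N) : ratioExp a i r = 0 ↔ r = i := by
  rw [← ZeroMemClass.coe_eq_zero, coe_ratioExp, sub_eq_zero]
  refine ⟨fun h => ?_, fun h => by rw [h]⟩
  by_contra hn
  have := congrFun h r
  simp [e, hn] at this

variable (a b) in
/-- The monomial `v_r x^(a r)`, divided by `v_i x^(a i)` in the expansion at `a i`. -/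
def ratio (r : Fin N) : Expansions a b := fun i => FormalSeries.single (ratioExp a (b i) r)

variable (a b) in
/-- The polynomial `∑ r, (v_r x^(a r)) ^ q`, divided by `(v_i x^(a i)) ^ q` in the expansion
at `a i`. -/
def powSum (q : ℕ) : Expansions a b := ∑ r, ratio a b r ^ q

variable (a b) in
/-- The expansions of `1 / ∑ r, (v_r x^(a r)) ^ q`. -/
def powSumInv (q : ℕ) : Expansions a b := Ring.inverse (powSum a b q)

/-- The constant coefficient of the expansion at `a i`. -/
def constCoeffAt (i : J) : Expansions a b →+* ℤ :=
  (FormalSeries.constCoeff _).comp (Pi.evalRingHom _ i)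

theorem constCoeffAt_apply (i : J) (w : Expansions a b) : constCoeffAt i w = (w i).coeff 0 := rfl

theorem coeff_zero_ctFam (i : J) (w : Expansions a b) :
    (ctFam w i).coeff 0 = constCoeffAt i w := by
  rw [ctFam_apply, ct_coeff, map_zero, constCoeffAt_apply]

theorem constCoeffAt_ratio (i : J) (r : Fin N) :
    constCoeffAt i (ratio a b r) = if r = b i then 1 else 0 := by
  rw [constCoeffAt_apply, ratio, FormalSeries.coeff_single]
  simp only [eq_comm (a := (0 : expCone a (b i))), ratioExp_eq_zero_iff]

theorem constCoeffAt_powSum (i : J) {q : ℕ} (hq : q ≠ 0) : constCoeffAt i (powSum a b q) = 1 := by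
  rw [powSum, map_sum]
  simp [constCoeffAt_ratio, ite_pow, hq]

theorem powSum_mul_inv {q : ℕ} (hq : q ≠ 0) : powSum a b q * powSumInv a b q = 1 := by
  refine Ring.mul_inverse_cancel _ (Pi.isUnit_iff.mpr fun i => ?_)
  exact FormalSeries.isUnit_of_coeff_zero (constCoeffAt_powSum i hq)

theorem constCoeffAt_powSumInv (i : J) {q : ℕ} (hq : q ≠ 0) :
    constCoeffAt i (powSumInv a b q) = 1 := by
  have := congrArg (constCoeffAt i) (powSum_mul_inv (a := a) (b := b) hq)
  rwa [map_mul, map_one, constCoeffAt_powSum i hq, one_mul] at this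

theorem coe_sum_ratioExp (i : Fin N) (κ : Fin N → ℕ) :
    ((∑ r, κ r • ratioExp a i r : expCone a i) : Fin N → ℤ) =
      (fun r => (κ r : ℤ)) - (∑ r, κ r) • e i := by
  rw [AddSubmonoid.coe_finsetSum]
  simp only [AddSubmonoidClass.coe_nsmul, coe_ratioExp, smul_sub, Finset.sum_sub_distrib,
    ← Finset.sum_smul]
  congr 1
  funext s
  simp [e, Finset.sum_apply, Pi.single_apply]

theorem prod_ratio_pow (i : J) (κ : Fin N → ℕ) :
    (∏ r, ratio a b r ^ κ r) i = FormalSeries.single (∑ r, κ r • ratioExp a (b i) r) := by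
  rw [Finset.prod_apply, ← FormalSeries.prod_single]
  refine Finset.prod_congr rfl fun r _ => ?_
  rw [Pi.pow_apply, ratio, FormalSeries.single_pow]

theorem deg_e (r : Fin N) : deg a (e r) = a r := by
  simp [deg, e, Pi.single_apply]

theorem ratio_pow_mem_cartierFixed (q : ℕ) (r : Fin N) :
    ratio a b r ^ q ∈ cartierFixed a b q := by
  classical
  change cartier q _ = _
  ext i l
  rw [cartier_apply, FormalSeries.restrict_coeff, Pi.pow_apply, ratio, FormalSeries.single_pow,
    FormalSeries.coeff_single]
  by_cases hl : l = q • ratioExp a (b i) r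
  · rw [if_pos]
    intro d
    rw [hl, AddSubmonoidClass.coe_nsmul, map_nsmul, Pi.smul_apply, nsmul_eq_mul]
    exact dvd_mul_right _ _
  · simp [hl]

theorem powSum_mem_cartierFixed (q : ℕ) : powSum a b q ∈ cartierFixed a b q :=
  Subring.sum_mem _ fun r _ => ratio_pow_mem_cartierFixed q r

theorem powSumInv_mem_cartierFixed {q : ℕ} (hq : q ≠ 0) :
    powSumInv a b q ∈ cartierFixed a b q := by
  have h1 := congrArg (cartier q) (powSum_mul_inv (a := a) (b := b) hq)
  rw [cartier_mul (powSum_mem_cartierFixed q),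
    show cartier q 1 = 1 from one_mem (cartierFixed a b q), ← powSum_mul_inv hq] at h1
  have h2 := congrArg (powSumInv a b q * ·) h1
  rw [mem_cartierFixed]
  simpa only [← mul_assoc, mul_comm (powSumInv a b q) (powSum a b q), powSum_mul_inv hq, one_mul,
    mul_one]
    using h2

/-! ### The matrices of constant terms and the projection along the basic forms -/

variable (a b) in
/-- The family of expansions of `(v_k x^(a k)) ^ q / ∑ r, (v_r x^(a r)) ^ q`. -/
def basicForm (q : ℕ) (k : J) : Expansions a b := ratio a b (b k) ^ q * powSumInv a b q

variable (a b) in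
/-- The matrix of the constant terms of the basic forms. -/
def periodMatrix (q : ℕ) : Matrix J J (ConeSeries a) := Matrix.of fun k => ctFam (basicForm a b q k)

theorem periodMatrix_apply (q : ℕ) (k : J) : periodMatrix a b q k = ctFam (basicForm a b q k) := rfl

theorem constCoeffAt_basicForm [DecidableEq J] (hb : Function.Injective b) {q : ℕ} (hq : q ≠ 0)
    (k i : J) : constCoeffAt i (basicForm a b q k) = if k = i then 1 else 0 := by
  rw [basicForm, map_mul, map_pow, constCoeffAt_ratio, constCoeffAt_powSumInv i hq, mul_one,
    ite_pow, one_pow, zero_pow hq]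
  simp only [hb.eq_iff]

theorem isUnit_of_coeff_zero {c : ConeSeries a} (hc : c.coeff 0 = 1) : IsUnit c := by
  rw [← MulEquiv.isUnit_map (seriesEquiv (a := a))]
  exact FormalSeries.isUnit_of_coeff_zero hc

variable [Fintype J] [DecidableEq J]

theorem matrix_isUnit_of_coeff_zero {A : Matrix J J (ConeSeries a)}
    (hA : ∀ j i, (A j i).coeff 0 = if j = i then 1 else 0) : IsUnit A := by
  rw [Matrix.isUnit_iff_isUnit_det]
  refine isUnit_of_coeff_zero ?_
  let ε : ConeSeries a →+* ℤ := (FormalSeries.constCoeff _).comp (seriesEquiv (a := a)).toRingHom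
  have h : ε.mapMatrix A = 1 := by
    ext j i
    rw [Matrix.one_apply, ← hA j i]
    rfl
  have h2 := RingHom.map_det ε A
  rwa [h, Matrix.det_one] at h2

theorem isUnit_periodMatrix (hb : Function.Injective b) {q : ℕ} (hq : q ≠ 0) :
    IsUnit (periodMatrix a b q) := by
  refine matrix_isUnit_of_coeff_zero fun k i => ?_
  rw [periodMatrix_apply, coeff_zero_ctFam, constCoeffAt_basicForm hb hq]

/-- The projection with kernel the span of the basic forms and with values in the families with
vanishing constant terms. -/
def proj (q : ℕ) : Expansions a b →+ Expansions a b :=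
  AddMonoidHom.mk'
    (fun w => w - ∑ k, constFam b ((ctFam w ᵥ* (periodMatrix a b q)⁻¹) k) * basicForm a b q k)
    (by
      intro w w'
      simp only [map_add, Matrix.add_vecMul, Pi.add_apply, add_mul, Finset.sum_add_distrib]
      abel)

theorem proj_apply (q : ℕ) (w : Expansions a b) : proj q w =
    w - ∑ k, constFam b ((ctFam w ᵥ* (periodMatrix a b q)⁻¹) k) * basicForm a b q k := rfl

theorem proj_constFam_mul (q : ℕ) (c : ConeSeries a) (w : Expansions a b) :
    proj q (constFam b c * w) = constFam b c * proj q w := by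
  rw [proj_apply, proj_apply, ctFam_constFam_mul, Matrix.smul_vecMul]
  simp only [Pi.smul_apply, smul_eq_mul, map_mul, mul_assoc, mul_sub, Finset.mul_sum]

theorem proj_basicForm (hb : Function.Injective b) {q : ℕ} (hq : q ≠ 0) (k : J) :
    proj q (basicForm a b q k) = 0 := by
  have h := (Matrix.isUnit_iff_isUnit_det _).mp (isUnit_periodMatrix (a := a) hb hq)
  rw [proj_apply, ← periodMatrix_apply, ← Matrix.mul_apply_eq_vecMul, Matrix.mul_nonsing_inv _ h,
    Finset.sum_eq_single k]
  · simp
  · intro k' _ hk'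
    simp [Matrix.one_apply_ne hk'.symm]
  · simp

theorem proj_eq_self (q : ℕ) {w : Expansions a b} (hw : ctFam w = 0) : proj q w = w := by
  simp [proj_apply, hw]

theorem ctFam_proj (hb : Function.Injective b) {q : ℕ} (hq : q ≠ 0) (w : Expansions a b) :
    ctFam (proj q w) = 0 := by
  have h := (Matrix.isUnit_iff_isUnit_det _).mp (isUnit_periodMatrix (a := a) hb hq)
  rw [proj_apply, map_sub, map_sum, sub_eq_zero]
  simp only [ctFam_constFam_mul, ← periodMatrix_apply]
  rw [← Matrix.vecMul_eq_sum, Matrix.vecMul_vecMul, Matrix.nonsing_inv_mul _ h, Matrix.vecMul_one]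

end

section

variable {N n : ℕ} {a : Fin N ↪ (Fin n → ℤ)} {J : Type} {b : J → Fin N}

/-! ### Divisibility of the coefficients of expansions -/

theorem smul_coeff (m : ℤ) (w : Expansions a b) (i : J) (l : expCone a (b i)) :
    ((m • w) i).coeff l = m * (w i).coeff l := by
  rw [Pi.smul_apply, zsmul_eq_mul, FormalSeries.coeff_intCast_mul]

variable (a b) in
/-- The families of expansions whose coefficients in degrees divisible by `q * p ^ t` are divisible
by `p ^ (t + ε)`, for all `t ≤ s`. For `ε = 0` and `s = ∞` this is Katz's description of the formal
derivatives. -/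
def derivLike (p ε s q : ℕ) : AddSubgroup (Expansions a b) where
  carrier := {w | ∀ i l, ∀ t ≤ s, l ∈ degDvd (q * p ^ t) (b i) → (p : ℤ) ^ (t + ε) ∣ (w i).coeff l}
  zero_mem' i l t _ _ := by
    rw [Pi.zero_apply, FormalSeries.coeff_zero]
    exact dvd_zero _
  add_mem' hw hw' i l t ht hl := by
    rw [Pi.add_apply, FormalSeries.coeff_add]
    exact dvd_add (hw i l t ht hl) (hw' i l t ht hl)
  neg_mem' hw i l t ht hl := by
    rw [Pi.neg_apply, FormalSeries.coeff_neg]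
    exact (hw i l t ht hl).neg_right

variable {p ε s q : ℕ}

theorem constFam_mul_mem_derivLike (c : ConeSeries a) {w : Expansions a b}
    (hw : w ∈ derivLike a b p ε s q) : constFam b c * w ∈ derivLike a b p ε s q := by
  intro i l t ht hl
  rw [Pi.mul_apply, FormalSeries.coeff_mul]
  refine Finset.dvd_sum fun x hx => ?_
  by_cases hx0 : deg a x.1 = 0
  · refine dvd_mul_of_dvd_right (hw i x.2 t ht fun d => ?_) _
    have := hl d
    rwa [← mem_antidiagonal.mp hx, AddSubmonoid.coe_add, map_add, hx0, zero_add] at this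
  · rw [constFam_apply, const_coeff_of_deg _ _ _ hx0, zero_mul]
    exact dvd_zero _

theorem smul_mem_derivLike {w : Expansions a b} (hw : w ∈ derivLike a b p 0 s q) :
    (p : ℤ) • w ∈ derivLike a b p 1 s q := by
  intro i l t ht hl
  rw [smul_coeff, pow_succ']
  exact mul_dvd_mul_left _ (hw i l t ht hl)

theorem mem_derivLike_zero (w : Expansions a b) : w ∈ derivLike a b p 0 0 q := by
  intro i l t ht _
  obtain rfl : t = 0 := by omega
  simp

theorem mem_derivLike_succ {w : Expansions a b} :
    w ∈ derivLike a b p 0 (s + 1) q ↔ cartier (q * p) w ∈ derivLike a b p 1 s (q * p) := by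
  have hsub : ∀ (i : J) (t : ℕ), degDvd (a := a) (q * p * p ^ t) (b i) ⊆ degDvd (q * p) (b i) := by
    intro i t l hl d
    refine dvd_trans ?_ (hl d)
    exact_mod_cast dvd_mul_right _ _
  constructor
  · intro hw i l t ht hl
    rw [cartier_apply, FormalSeries.restrict_coeff, if_pos (hsub i t hl)]
    refine hw i l (t + 1) (by omega) ?_
    rwa [pow_succ', ← mul_assoc]
  · intro hw i l t ht hl
    cases t with
    | zero => simp
    | succ t =>
      rw [pow_succ', ← mul_assoc] at hl
      have := hw i l t (by omega) hl
      rwa [cartier_apply, FormalSeries.restrict_coeff, if_pos (hsub i t hl)] at this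

theorem exists_smul_eq_cartier (hp : p ≠ 0) {w : Expansions a b}
    (hw : w ∈ derivLike a b p 1 s q) :
    ∃ w' ∈ derivLike a b p 0 s q, cartier q w = (p : ℤ) • w' := by
  classical
  have h : ∀ i l, ∃ z : ℤ, (cartier q w i).coeff l = p * z := by
    intro i l
    rw [cartier_apply, FormalSeries.restrict_coeff]
    split_ifs with hl
    · have := hw i l 0 (Nat.zero_le _) (by simpa using hl)
      rwa [zero_add, pow_one] at this
    · exact ⟨0, by simp⟩
  choose z hz using h
  refine ⟨fun i => ⟨z i⟩, fun i l t ht hl => ?_, ?_⟩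
  · have h1 := hw i l t ht hl
    have h2 := hz i l
    rw [cartier_apply, FormalSeries.restrict_coeff, if_pos] at h2
    · rw [h2, pow_succ'] at h1
      exact Int.dvd_of_mul_dvd_mul_left (by exact_mod_cast hp) h1
    · intro d
      refine dvd_trans ?_ (hl d)
      exact_mod_cast dvd_mul_right _ _
  · ext i l
    rw [smul_coeff, hz]

/-! ### Truncation by weight -/

variable (a b) in
/-- The families of expansions all of whose terms have weight at least `Q`. -/
def highFam (Q : ℕ) : Ideal (Expansions a b) :=
  ⨅ i : J, (FormalSeries.high (expCone a (b i)) Q).comap (Pi.evalRingHom _ i)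

theorem mem_highFam {Q : ℕ} {w : Expansions a b} :
    w ∈ highFam a b Q ↔ ∀ i, w i ∈ FormalSeries.high (expCone a (b i)) Q := by
  simp [highFam]

theorem pow_mem_highFam {w : Expansions a b} (hw : ∀ i, constCoeffAt i w = 0) (Q : ℕ) :
    w ^ Q ∈ highFam a b Q :=
  mem_highFam.mpr fun i => FormalSeries.pow_mem_high (FormalSeries.mem_high_one.mpr (hw i)) Q

theorem cartier_mem_highFam {Q : ℕ} {w : Expansions a b} (hw : w ∈ highFam a b Q) :
    cartier q w ∈ highFam a b Q := by
  rw [mem_highFam] at hw ⊢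
  intro i l hl
  rw [cartier_apply, FormalSeries.restrict_coeff, hw i l hl, ite_self]

theorem proj_mem_highFam [Fintype J] [DecidableEq J] {Q : ℕ} {w : Expansions a b}
    (hw : w ∈ highFam a b Q) : proj q w ∈ highFam a b Q := by
  let I : Ideal (ConeSeries a) := (FormalSeries.high (latticeCone a) Q).comap seriesEquiv
  have h1 : ∀ i, ctFam w i ∈ I := fun i l hl => by
    rw [seriesEquiv_coeff, ctFam_apply, ct_coeff]
    exact mem_highFam.mp hw i _ (by rwa [wt_inclCone])
  have h2 : ∀ k, (ctFam w ᵥ* (periodMatrix a b q)⁻¹) k ∈ I := fun k =>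
    Ideal.sum_mem _ fun i _ => Ideal.mul_mem_right _ _ (h1 i)
  have h3 : ∀ c ∈ I, constFam b c ∈ highFam a b Q := by
    refine fun c hc => mem_highFam.mpr fun i l hl => ?_
    by_cases h : deg a l = 0
    · obtain ⟨l, rfl⟩ := exists_inclCone h
      rw [constFam_apply, const_coeff]
      exact hc l (by rwa [wt_inclCone] at hl)
    · rw [constFam_apply, const_coeff_of_deg _ _ _ h]
  rw [proj_apply]
  exact sub_mem hw (sum_mem fun k _ => Ideal.mul_mem_right _ _ (h3 _ (h2 k)))

/-- The families in `derivLike` are closed under limits for the weight topology. -/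
theorem mem_derivLike_of_forall_high {w : Expansions a b}
    (hw : ∀ Q, ∃ w' ∈ derivLike a b p ε s q, w - w' ∈ highFam a b Q) :
    w ∈ derivLike a b p ε s q := by
  intro i l t ht hl
  obtain ⟨w', hw', h⟩ := hw (PosWeight.wt l + 1)
  have := mem_highFam.mp h i l (by omega)
  rw [Pi.sub_apply, FormalSeries.coeff_sub, sub_eq_zero] at this
  rw [this]
  exact hw' i l t ht hl

/-! ### The Frobenius congruence for the generic polynomial -/

theorem exists_homogeneous_frobenius_defect (p q : ℕ) [hp : Fact p.Prime] (N : ℕ) :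
    ∃ G : MvPolynomial (Fin N) ℤ, G.IsHomogeneous (q * p) ∧
      ∑ r, MvPolynomial.X r ^ (q * p) - (∑ r, MvPolynomial.X r ^ q) ^ p =
        MvPolynomial.C (p : ℤ) * G := by
  have h : MvPolynomial.C (p : ℤ) ∣ (∑ r, MvPolynomial.X r ^ (q * p) -
      (∑ r, MvPolynomial.X r ^ q) ^ p : MvPolynomial (Fin N) ℤ) := by
    rw [MvPolynomial.C_dvd_iff_zmod]
    simp only [map_sub, map_sum, map_pow, MvPolynomial.map_X, sum_pow_char, ← pow_mul, sub_self]
  obtain ⟨G, hG⟩ := h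
  refine ⟨G, fun {ν} hν => ?_, hG⟩
  have h1 : (MvPolynomial.C (p : ℤ) * G).IsHomogeneous (q * p) := by
    rw [← hG]
    refine MvPolynomial.IsHomogeneous.sub ?_ ?_
    · exact MvPolynomial.IsHomogeneous.sum _ _ _ fun r _ => by
        simpa using (MvPolynomial.isHomogeneous_X ℤ r).pow (q * p)
    · refine MvPolynomial.IsHomogeneous.pow ?_ p
      exact MvPolynomial.IsHomogeneous.sum _ _ _ fun r _ => by
        simpa using (MvPolynomial.isHomogeneous_X ℤ r).pow q
  refine h1 ?_
  rw [MvPolynomial.coeff_C_mul]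
  exact mul_ne_zero (by exact_mod_cast hp.out.ne_zero) hν

/-- Powers of an inverse of `1 - h` are polynomials in `h` up to multiples of `h ^ Q`. -/
theorem exists_polynomial_approx {A : Type*} [CommRing A] {h v : A} (hv : (1 - h) * v = 1)
    (r Q : ℕ) : ∃ (P : Polynomial ℤ) (y : A), v ^ r =
      Polynomial.eval₂ (Int.castRingHom A) h P + h ^ Q * y := by
  have h1 : v - ∑ k ∈ Finset.range Q, h ^ k = h ^ Q * v := by
    linear_combination (-v) * mul_neg_geom_sum h Q + (∑ k ∈ Finset.range Q, h ^ k) * hv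
  have h2 := sub_dvd_pow_sub_pow v (∑ k ∈ Finset.range Q, h ^ k) r
  rw [h1] at h2
  obtain ⟨y, hy⟩ := h2
  refine ⟨(∑ k ∈ Finset.range Q, Polynomial.X ^ k) ^ r, v * y, ?_⟩
  rw [Polynomial.eval₂_pow, Polynomial.eval₂_finsetSum]
  simp only [Polynomial.eval₂_pow, Polynomial.eval₂_X]
  rw [← mul_assoc, ← hy]
  ring

end

section

variable {N n : ℕ} {a : Fin N ↪ (Fin n → ℤ)} {J : Type} {b : J → Fin N}
variable {p ε s q : ℕ}

/-! ### The Cartier operator on rational functions -/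

variable (a b) in
/-- The lattice points of the open set are among the exponents: if a monomial of degree `q` in the
`v_r x^(a r)` involves one of the variables `v_k`, `k ∈ J`, and its degree in `x` is divisible by
`q`, then this degree is `q • a k'` for some `k' ∈ J`. -/
def Saturated : Prop :=
  ∀ q : ℕ, q ≠ 0 → ∀ κ : Fin N → ℕ, ∑ r, κ r = q →
    (∀ d, (q : ℤ) ∣ deg a (fun r => (κ r : ℤ)) d) → (∃ k, κ (b k) ≠ 0) →
      ∃ k, deg a (fun r => (κ r : ℤ)) = q • a (b k)

theorem deg_sum_ratioExp (i : Fin N) (κ : Fin N → ℕ) :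
    deg a (∑ r, κ r • ratioExp a i r : expCone a i) =
      deg a (fun r => (κ r : ℤ)) - (∑ r, κ r) • a i := by
  rw [coe_sum_ratioExp, map_sub, map_nsmul, deg_e]

open Classical in
theorem cartier_prod_ratio (κ : Fin N → ℕ) (hq : q ∣ ∑ r, κ r) :
    cartier q (∏ r, ratio a b r ^ κ r) =
      if ∀ d, (q : ℤ) ∣ deg a (fun r => (κ r : ℤ)) d then ∏ r, ratio a b r ^ κ r else 0 := by
  ext i l
  have hmem : ∑ r, κ r • ratioExp a (b i) r ∈ degDvd q (b i) ↔
      ∀ d, (q : ℤ) ∣ deg a (fun r => (κ r : ℤ)) d := by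
    refine forall_congr' fun d => ?_
    rw [deg_sum_ratioExp, Pi.sub_apply]
    refine dvd_sub_left ?_
    rw [Pi.smul_apply, nsmul_eq_mul]
    exact dvd_mul_of_dvd_left (by exact_mod_cast hq) _
  rw [cartier_apply, FormalSeries.restrict_coeff]
  by_cases hl : l = ∑ r, κ r • ratioExp a (b i) r
  · subst hl
    simp only [hmem]
    split_ifs <;> rfl
  · have h0 : ((∏ r, ratio a b r ^ κ r) i).coeff l = 0 := by
      rw [prod_ratio_pow, FormalSeries.coeff_single, if_neg hl]
    rw [h0, ite_self]
    split_ifs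
    · exact h0.symm
    · rfl

theorem prod_ratio_single (r : Fin N) (m : ℕ) :
    ∏ r', ratio a b r' ^ (Pi.single r m : Fin N → ℕ) r' = ratio a b r ^ m := by
  rw [Finset.prod_eq_single r]
  · rw [Pi.single_eq_same]
  · intro r' _ hr'
    rw [Pi.single_eq_of_ne hr', pow_zero]
  · simp

/-- A monomial of the degree of a basic form is a multiple of it by an element of `𝓡`. -/
theorem exists_prod_ratio_eq (κ : Fin N → ℕ) (k : J) (hκ : ∑ r, κ r = q)
    (hk : deg a (fun r => (κ r : ℤ)) = q • a (b k)) :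
    ∃ c : ConeSeries a, ∏ r, ratio a b r ^ κ r = constFam b c * ratio a b (b k) ^ q := by
  set x : Fin N → ℤ := (fun r => (κ r : ℤ)) - q • e (b k) with hxdef
  have hx : x ∈ latticeCone a := by
    refine mem_latticeCone_of_nonneg (b k) ?_ ?_ ?_
    · have : ∑ r, (κ r : ℤ) = q := by exact_mod_cast hκ
      simp [x, Finset.sum_sub_distrib, this, e, ← Finset.mul_sum]
    · rw [map_sub, map_nsmul, deg_e, hk, sub_self]
    · intro r hr
      simp [x, e, hr]
  refine ⟨seriesEquiv.symm (FormalSeries.single ⟨x, hx⟩), ?_⟩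
  ext1 i
  have hc : constFam b (seriesEquiv.symm (FormalSeries.single ⟨x, hx⟩)) i =
      FormalSeries.single (inclCone (b i) ⟨x, hx⟩) := by
    rw [constFam_apply, const]
    simp only [RingEquiv.toRingHom_eq_coe, RingHom.coe_comp, RingHom.coe_coe, Function.comp_apply,
      RingEquiv.apply_symm_apply]
    exact FormalSeries.map_single _ _ _
  rw [prod_ratio_pow, Pi.mul_apply, hc, Pi.pow_apply, ratio, FormalSeries.single_pow,
    FormalSeries.single_mul_single]
  congr 1
  apply Subtype.ext
  rw [coe_sum_ratioExp, AddSubmonoid.coe_add, coe_inclCone, AddSubmonoidClass.coe_nsmul,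
    coe_ratioExp, hκ, smul_sub]
  simp only [x]
  abel

variable [Fintype J] [DecidableEq J]

variable (a b) in
/-- Rational functions with pole order `ρ`, normalized by `p ^ (ρ - 2)`, are congruent to
combinations of the basic forms up to families in `derivLike`. The factor `p ^ (ρ - 2)`, which is
`1` for `ρ = 1`, is what makes the Cartier operator gain a factor `p` on all terms with a pole of
order at least two, for `p = 2` as well. -/
def Reduces (p s q : ℕ) : Prop :=
  ∀ (ρ : ℕ) (κ : Fin N → ℕ), 1 ≤ ρ → ∑ r, κ r = q * ρ →
    (∀ d, (q : ℤ) ∣ deg a (fun r => (κ r : ℤ)) d) → (∃ k, κ (b k) ≠ 0) →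
      proj q ((p : ℤ) ^ (ρ - 2) • ((∏ r, ratio a b r ^ κ r) * powSumInv a b q ^ ρ)) ∈
        derivLike a b p 0 s q

/-- The image of a monomial over the `ρ`-th power under the Cartier operator: it vanishes after
projection if `ρ = 1`, and is covered by the induction hypothesis, with a factor `p` to spare,
if `ρ ≥ 2`. -/
theorem proj_cartier_monomial_mem (hb : Function.Injective b) (hsat : Saturated a b) (hq : q ≠ 0)
    (hK : Reduces a b p s q) {ρ : ℕ} (hρ : 1 ≤ ρ) {κ : Fin N → ℕ} (hκ : ∑ r, κ r = q * ρ)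
    (hk : ∃ k, κ (b k) ≠ 0) {M : ℤ} (hM : (p : ℤ) ^ (ρ - 1) ∣ M) :
    proj q (cartier q (M • ((∏ r, ratio a b r ^ κ r) * powSumInv a b q ^ ρ))) ∈
      derivLike a b p 1 s q := by
  rw [map_zsmul, map_zsmul, mul_comm, cartier_mul (pow_mem (powSumInv_mem_cartierFixed hq) ρ),
    cartier_prod_ratio κ (hκ ▸ dvd_mul_right q ρ)]
  split_ifs with hd
  · obtain rfl | hρ2 : ρ = 1 ∨ 2 ≤ ρ := by omega
    · -- A simple pole gives a multiple of a basic form.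
      rw [mul_one] at hκ
      obtain ⟨k, hk⟩ := hsat q hq κ hκ hd hk
      obtain ⟨c, hc⟩ := exists_prod_ratio_eq κ k hκ hk
      rw [hc, pow_one, mul_comm, mul_assoc, ← basicForm, proj_constFam_mul, proj_basicForm hb hq,
        mul_zero, smul_zero]
      exact zero_mem _
    · obtain ⟨M', rfl⟩ := hM
      obtain ⟨ρ, rfl⟩ : ∃ ρ', ρ = ρ' + 2 := ⟨ρ - 2, by omega⟩
      have := hK (ρ + 2) κ hρ hκ hd hk
      rw [map_zsmul, mul_comm] at this
      have h2 := AddSubgroup.zsmul_mem _ (smul_mem_derivLike this) M'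
      rw [smul_smul, smul_smul] at h2
      convert h2 using 2
      rw [show ρ + 2 - 1 = ρ + 1 by omega, show ρ + 2 - 2 = ρ by omega]
      ring
  · rw [mul_zero, map_zero, smul_zero]
    exact zero_mem _

theorem proj_cartier_mem (hb : Function.Injective b) (hsat : Saturated a b) (hq : q ≠ 0)
    (hK : Reduces a b p s q) {ρ D : ℕ} (hρ : 1 ≤ ρ) {κ : Fin N → ℕ}
    {F : MvPolynomial (Fin N) ℤ} (hF : F.IsHomogeneous D) (hκ : ∑ r, κ r + D = q * ρ)
    (hk : ∃ k, κ (b k) ≠ 0) {M : ℤ} (hM : (p : ℤ) ^ (ρ - 1) ∣ M) :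
    proj q (cartier q (M • ((∏ r, ratio a b r ^ κ r) * MvPolynomial.aeval (ratio a b) F *
      powSumInv a b q ^ ρ))) ∈ derivLike a b p 1 s q := by
  rw [MvPolynomial.aeval_def, MvPolynomial.eval₂_eq', Finset.mul_sum, Finset.sum_mul,
    Finset.smul_sum, map_sum, map_sum]
  refine AddSubgroup.sum_mem _ fun ν hν => ?_
  have hdeg : ∑ r, ν r = D := by
    have := hF (MvPolynomial.mem_support_iff.mp hν)
    rwa [Finsupp.weight_apply, Finsupp.sum_fintype _ _ (by simp), Finset.sum_congr rfl] at this
    simp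
  obtain ⟨k, hk⟩ := hk
  have h := proj_cartier_monomial_mem hb hsat hq hK hρ (κ := κ + ν) (M := M * F.coeff ν)
    (by simp only [Pi.add_apply, Finset.sum_add_distrib, hdeg, hκ])
    ⟨k, by simp [hk]⟩ (dvd_mul_of_dvd_left hM _)
  convert h using 3
  rw [← smul_smul]
  congr 1
  simp only [Pi.add_apply, pow_add, Finset.prod_mul_distrib, eq_intCast,
    zsmul_eq_mul]
  ring

variable [hp : Fact p.Prime]

/-- The Cartier operator maps a rational function with denominator a power of `f = ∑ y_r ^ q` to a
combination of basic forms for `f^σ = ∑ y_r ^ (q p)` plus `p` times normalized rational functions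
with denominators powers of `f^σ`, in the limit for the weight topology. -/
theorem reduces_cartier (hb : Function.Injective b) (hsat : Saturated a b) (hq : q ≠ 0)
    (hK : Reduces a b p s (q * p)) {ρ : ℕ} (hρ : 1 ≤ ρ) {κ : Fin N → ℕ}
    (hκ : ∑ r, κ r = q * ρ) (hk : ∃ k, κ (b k) ≠ 0) :
    proj (q * p) (cartier (q * p)
      ((p : ℤ) ^ (ρ - 2) • ((∏ r, ratio a b r ^ κ r) * powSumInv a b q ^ ρ))) ∈
        derivLike a b p 1 s (q * p) := by
  have hp2 := hp.out.two_le
  have hq' : q * p ≠ 0 := mul_ne_zero hq hp.out.ne_zero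
  -- `1 / f ^ ρ` is rewritten with denominator `(f ^ p) ^ ρ'`, where `ρ' = ρ - 1` if `ρ ≥ 2`: the
  -- drop of the pole order yields the factor `p` in the term without any `p * G`.
  obtain ⟨ρ', hρ'1, hρ', hpow⟩ : ∃ ρ', 1 ≤ ρ' ∧ ρ ≤ p * ρ' ∧ ∀ k, ρ' + k - 1 ≤ ρ - 2 + k := by
    refine ⟨max (ρ - 1) 1, le_max_right _ _, ?_, fun k => ?_⟩
    · have h1 : 2 * max (ρ - 1) 1 ≤ p * max (ρ - 1) 1 := Nat.mul_le_mul_right _ hp2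
      omega
    · omega
  obtain ⟨G, hGh, hG⟩ := exists_homogeneous_frobenius_defect p q N
  set g := MvPolynomial.aeval (ratio a b) G with hg
  set φ := powSum a b q with hφ
  set u := powSumInv a b q with hu
  set φ' := powSum a b (q * p) with hφ'
  set u' := powSumInv a b (q * p) with hu'
  have hφu : φ * u = 1 := powSum_mul_inv hq
  have hφu' : φ' * u' = 1 := powSum_mul_inv hq'
  have hf : MvPolynomial.aeval (ratio a b) (∑ r, MvPolynomial.X r ^ q : MvPolynomial (Fin N) ℤ) =
      φ := by
    simp [hφ, powSum]
  have hdef : φ' - φ ^ p = p * g := by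
    have := congrArg (MvPolynomial.aeval (ratio a b)) hG
    rw [map_sub, map_pow, hf, map_mul, MvPolynomial.aeval_C] at this
    simpa [hφ', powSum] using this
  set h : Expansions a b := p * g * u' with hh
  have h1 : h = 1 - φ ^ p * u' := by rw [hh, ← hdef, sub_mul, hφu']
  have hφup : φ ^ p * u ^ p = 1 := by rw [← mul_pow, hφu, one_pow]
  have hv : (1 - h) * (φ' * u ^ p) = 1 := by
    rw [h1]
    linear_combination φ ^ p * u ^ p * hφu' + hφup
  have hu_p : u ^ p = u' * (φ' * u ^ p) := by linear_combination (-u ^ p) * hφu'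
  have hconst : ∀ i, constCoeffAt i h = 0 := by
    intro i
    rw [h1, map_sub, map_mul, map_pow, constCoeffAt_powSum i hq, constCoeffAt_powSumInv i hq']
    simp
  have huρ : u ^ ρ = φ ^ (p * ρ' - ρ) * u' ^ ρ' * (φ' * u ^ p) ^ ρ' := by
    obtain ⟨D, hD⟩ := Nat.exists_eq_add_of_le' hρ'
    rw [mul_assoc, ← mul_pow, ← hu_p, ← pow_mul, hD, Nat.add_sub_cancel, pow_add, ← mul_assoc,
      ← mul_pow, hφu, one_pow, one_mul]
  -- The series in `h` converges for the weight, not `p`-adically when `p = 2`.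
  refine mem_derivLike_of_forall_high fun Q => ?_
  obtain ⟨P, y, hP⟩ := exists_polynomial_approx hv ρ' Q
  set Y := (∏ r, ratio a b r ^ κ r) * (φ ^ (p * ρ' - ρ) * u' ^ ρ') with hY
  refine ⟨proj (q * p) (cartier (q * p)
    ((p : ℤ) ^ (ρ - 2) • (Y * Polynomial.eval₂ (Int.castRingHom _) h P))), ?_, ?_⟩
  · rw [Polynomial.eval₂_eq_sum_range, Finset.mul_sum, Finset.smul_sum, map_sum, map_sum]
    refine AddSubgroup.sum_mem _ fun k _ => ?_
    have hFh : ((∑ r, MvPolynomial.X r ^ q : MvPolynomial (Fin N) ℤ) ^ (p * ρ' - ρ) *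
        G ^ k).IsHomogeneous (q * (p * ρ' - ρ) + q * p * k) := by
      refine MvPolynomial.IsHomogeneous.mul (MvPolynomial.IsHomogeneous.pow ?_ _) (hGh.pow k)
      exact MvPolynomial.IsHomogeneous.sum _ _ _ fun r _ => by
        simpa using (MvPolynomial.isHomogeneous_X ℤ r).pow q
    have := proj_cartier_mem hb hsat hq' hK (ρ := ρ' + k) (by omega) (κ := κ) hFh (by
        rw [hκ, ← add_assoc, ← mul_add, Nat.add_sub_cancel' hρ']; ring) hk
        (M := P.coeff k * (p : ℤ) ^ (ρ - 2 + k))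
        (dvd_mul_of_dvd_right (pow_dvd_pow _ (hpow k)) _)
    convert this using 3
    rw [map_mul, map_pow, map_pow, hf, ← hg, hY, hh]
    simp only [zsmul_eq_mul, eq_intCast]
    push_cast
    ring
  · rw [← map_sub, ← map_sub]
    refine proj_mem_highFam (cartier_mem_highFam ?_)
    have : (p : ℤ) ^ (ρ - 2) • ((∏ r, ratio a b r ^ κ r) * u ^ ρ) -
        (p : ℤ) ^ (ρ - 2) • (Y * Polynomial.eval₂ (Int.castRingHom _) h P) =
          ((p : ℤ) ^ (ρ - 2) • (Y * y)) * h ^ Q := by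
      rw [huρ, hP, hY]
      simp only [zsmul_eq_mul]
      ring
    rw [this]
    exact Ideal.mul_mem_left _ _ (pow_mem_highFam hconst Q)

theorem proj_cartier_basicForm_mem (hb : Function.Injective b) (hsat : Saturated a b) (hq : q ≠ 0)
    (hK : Reduces a b p s (q * p)) (k : J) :
    proj (q * p) (cartier (q * p) (basicForm a b q k)) ∈ derivLike a b p 1 s (q * p) := by
  have := reduces_cartier hb hsat hq hK le_rfl (κ := Pi.single (b k) q) (by simp) ⟨k, by simp [hq]⟩
  simpa [prod_ratio_single, basicForm] using this

/-- Modulo `derivLike`, all rational functions are combinations of the basic forms. -/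
theorem reduces (hb : Function.Injective b) (hsat : Saturated a b) (s : ℕ) :
    ∀ q, q ≠ 0 → Reduces a b p s q := by
  induction s with
  | zero => intro q _ ρ κ _ _ _ _; exact mem_derivLike_zero _
  | succ s ih =>
    intro q hq ρ κ hρ hκ _ hk
    have hq' : q * p ≠ 0 := mul_ne_zero hq hp.out.ne_zero
    rw [mem_derivLike_succ]
    set w := (p : ℤ) ^ (ρ - 2) • ((∏ r, ratio a b r ^ κ r) * powSumInv a b q ^ ρ) with hw
    -- The constant terms of `proj q w` vanish, and the Cartier operator preserves constant terms.
    rw [← proj_eq_self (q * p) (w := cartier (q * p) (proj q w))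
      (by rw [ctFam_cartier, ctFam_proj hb hq])]
    rw [proj_apply q, map_sub, map_sub, map_sum, map_sum]
    refine sub_mem (reduces_cartier hb hsat hq (ih _ hq') hρ hκ hk) (sum_mem fun k _ => ?_)
    rw [cartier_mul (constFam_mem_cartierFixed _ _), proj_constFam_mul]
    exact constFam_mul_mem_derivLike _ (proj_cartier_basicForm_mem hb hsat hq (ih _ hq') k)

end

section

variable {N n : ℕ} {a : Fin N ↪ (Fin n → ℤ)} {J : Type} {b : J → Fin N}
variable {p s q : ℕ}

/-! ### Truncated constant terms -/

theorem dvd_ctFam {m : ℕ} {w : Expansions a b} (hw : (m : Expansions a b) ∣ w) (i : J) :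
    (m : ConeSeries a) ∣ ctFam w i := by
  obtain ⟨w', rfl⟩ := hw
  rw [← nsmul_eq_mul, map_nsmul, Pi.smul_apply, nsmul_eq_mul]
  exact dvd_mul_right _ _

theorem prime_dvd_frobenius_defect [hp : Fact p.Prime] (q : ℕ) :
    (p : Expansions a b) ∣ (1 - powSum a b q) ^ p - (1 - powSum a b (q * p)) := by
  have h : MvPolynomial.C (p : ℤ) ∣ ((1 - ∑ r, MvPolynomial.X r ^ q) ^ p -
      (1 - ∑ r, MvPolynomial.X r ^ (q * p)) : MvPolynomial (Fin N) ℤ) := by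
    rw [MvPolynomial.C_dvd_iff_zmod]
    simp only [map_sub, map_sum, map_pow, map_one, MvPolynomial.map_X, sub_pow_char, sum_pow_char,
      ← pow_mul, one_pow, sub_self]
  have := map_dvd (MvPolynomial.aeval (ratio a b)) h
  simpa [powSum] using this

theorem pow_dvd_frobenius_defect [hp : Fact p.Prime] (q : ℕ) {m : ℕ} (hm : p ^ s ∣ m) :
    ((p ^ (s + 1) : ℕ) : Expansions a b) ∣
      (1 - powSum a b q) ^ (p * m) - (1 - powSum a b (q * p)) ^ m := by
  obtain ⟨m', rfl⟩ := hm
  have h := dvd_sub_pow_of_dvd_sub (prime_dvd_frobenius_defect (a := a) (b := b) (p := p) q) s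
  rw [pow_mul, pow_mul, pow_mul]
  refine dvd_trans ?_ (sub_dvd_pow_sub_pow _ _ m')
  exact_mod_cast h

/-- Constant terms truncated at an order divisible by `p ^ s` vanish modulo `p ^ s` on `derivLike`,
since `g ^ (p ^ s)` is, modulo `p ^ s`, a combination of functions of `x ^ (p ^ t)` with
coefficients divisible by `p ^ (s - t)`. -/
theorem dvd_ctFam_pow_mul [hp : Fact p.Prime] (s : ℕ) : ∀ (q m : ℕ), p ^ s ∣ m →
    ∀ w ∈ derivLike a b p 0 s q, ∀ i,
      ((p ^ s : ℕ) : ConeSeries a) ∣ ctFam ((1 - powSum a b q) ^ m * w) i := by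
  induction s with
  | zero => intro q m _ w _ i; simp
  | succ s ih =>
    intro q m hm w hw i
    obtain ⟨m, rfl⟩ : ∃ m', m = p * m' := (dvd_trans (dvd_pow_self p (by omega)) hm)
    have hm' : p ^ s ∣ m := by
      rw [pow_succ'] at hm
      exact Nat.dvd_of_mul_dvd_mul_left hp.out.pos hm
    obtain ⟨w', hw', hww'⟩ := exists_smul_eq_cartier hp.out.ne_zero (mem_derivLike_succ.mp hw)
    have hcar : cartier (q * p) (cartier (q * p) w) = cartier (q * p) w := by
      classical
      ext i l
      simp only [cartier_apply, FormalSeries.restrict_coeff]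
      split_ifs <;> rfl
    rw [hcar] at hww'
    set g := 1 - powSum a b (q * p) with hg
    have hgm : cartier (q * p) (g ^ m) = g ^ m :=
      pow_mem (sub_mem (one_mem _) (powSum_mem_cartierFixed (q * p))) m
    have h1 : ctFam (g ^ m * w) = p • ctFam (g ^ m * w') := by
      rw [← ctFam_cartier (q * p), cartier_mul hgm, hww', ← map_nsmul, natCast_zsmul,
        mul_smul_comm]
    have h2 : (1 - powSum a b q) ^ (p * m) * w =
        ((1 - powSum a b q) ^ (p * m) - g ^ m) * w + g ^ m * w := by ring
    rw [h2, map_add, Pi.add_apply, h1, Pi.smul_apply, nsmul_eq_mul]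
    refine dvd_add (dvd_ctFam (dvd_mul_of_dvd_left (pow_dvd_frobenius_defect q hm') _) i) ?_
    rw [pow_succ', Nat.cast_mul]
    exact mul_dvd_mul_left _ (ih (q * p) m hm' w' hw' i)

theorem dvd_ctFam_truncated_mul [hp : Fact p.Prime] {m : ℕ} (hm : p ^ s ∣ m) {w : Expansions a b}
    (hw : w ∈ derivLike a b p 0 s q) (i : J) :
    ((p ^ s : ℕ) : ConeSeries a) ∣ ctFam ((1 - (1 - powSum a b q) ^ m) * w) i := by
  have h0 := dvd_ctFam_pow_mul s q 0 (dvd_zero _) w hw i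
  rw [pow_zero, one_mul] at h0
  rw [sub_mul, one_mul, map_sub, Pi.sub_apply]
  exact dvd_sub h0 (dvd_ctFam_pow_mul s q m hm w hw i)

variable (a b) in
/-- The matrix of the truncated constant terms of the basic forms. -/
def truncMatrix (q m : ℕ) : Matrix J J (ConeSeries a) :=
  Matrix.of fun k => ctFam ((1 - (1 - powSum a b q) ^ m) * basicForm a b q k)

theorem truncMatrix_apply (q m : ℕ) (k : J) : truncMatrix a b q m k =
    ctFam ((1 - (1 - powSum a b q) ^ m) * basicForm a b q k) := rfl

/-! ### The Frobenius lift -/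

variable (p) in
theorem nsmul_expCone_injective (hp : p ≠ 0) (i : Fin N) :
    Function.Injective (nsmulAddMonoidHom (α := expCone a i) p) := by
  intro x y hxy
  refine Subtype.ext (funext fun r => ?_)
  have := congrFun (congrArg Subtype.val hxy) r
  simpa [hp] using this

variable (p) in
/-- The Frobenius lift on families of expansions; it maps `x ^ u` to `x ^ (p u)`. -/
def frobFam [hp : Fact p.Prime] : Expansions a b →+* Expansions a b :=
  RingHom.pi fun i => (FormalSeries.map (nsmulAddMonoidHom p)
    (nsmul_expCone_injective p hp.out.ne_zero (b i))).comp (Pi.evalRingHom _ i)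

section Frobenius

variable [hp : Fact p.Prime]

theorem frobFam_apply (w : Expansions a b) (i : J) : frobFam p w i =
    FormalSeries.map (nsmulAddMonoidHom p) (nsmul_expCone_injective p hp.out.ne_zero (b i)) (w i) :=
  rfl

theorem frob_ctFam (w : Expansions a b) (i : J) :
    ctFam (frobFam p w) i = frob a p (ctFam w i) := by
  have hinj := nsmul_expCone_injective (a := a) p hp.out.ne_zero (b i)
  ext l
  rw [ctFam_apply, ct_coeff, frobFam_apply]
  change _ = (frobCoeff a p _).coeff l
  by_cases h : ∃ k : latticeCone a, p • k = l
  · obtain ⟨k, rfl⟩ := h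
    rw [frobCoeff_nsmul hp.out.ne_zero, ctFam_apply, ct_coeff, map_nsmul]
    exact FormalSeries.map_coeff _ hinj _ _
  · rw [frobCoeff_of_not _ _ h]
    refine FormalSeries.map_coeff_of_not _ hinj _ _ ?_
    rintro ⟨k, hk⟩
    have hk' : p • k = inclCone (b i) l := hk
    have h0 : deg a k = 0 := by
      have := congrArg (fun z : expCone a (b i) => deg a z) hk'
      simp only [AddSubmonoidClass.coe_nsmul, map_nsmul, coe_inclCone,
        (sum_zero_of_mem_latticeCone l.2).2] at this
      exact (smul_eq_zero_iff_right hp.out.ne_zero).mp this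
    obtain ⟨k, rfl⟩ := exists_inclCone h0
    exact h ⟨k, inclCone_injective _ (by rw [map_nsmul, hk'])⟩

theorem frobFam_ratio (r : Fin N) : frobFam p (ratio a b r) = ratio a b r ^ p := by
  ext1 i
  rw [frobFam_apply, ratio, FormalSeries.map_single, Pi.pow_apply]
  exact (FormalSeries.single_pow _ _).symm

theorem frobFam_powSum (q : ℕ) : frobFam p (powSum a b q) = powSum a b (q * p) := by
  simp only [powSum, map_sum, map_pow, frobFam_ratio, ← pow_mul, mul_comm p]

theorem frobFam_powSumInv (hq : q ≠ 0) :
    frobFam p (powSumInv a b q) = powSumInv a b (q * p) := by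
  have h1 := congrArg (frobFam p) (powSum_mul_inv (a := a) (b := b) hq)
  rw [map_mul, map_one, frobFam_powSum] at h1
  have h2 := powSum_mul_inv (a := a) (b := b) (mul_ne_zero hq hp.out.ne_zero)
  linear_combination powSumInv a b (q * p) * h1 - frobFam p (powSumInv a b q) * h2

theorem frobFam_basicForm (hq : q ≠ 0) (k : J) :
    frobFam p (basicForm a b q k) = basicForm a b (q * p) k := by
  rw [basicForm, map_mul, map_pow, frobFam_ratio, frobFam_powSumInv hq, ← pow_mul, mul_comm p,
    basicForm]

theorem periodMatrix_map_frob (hq : q ≠ 0) :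
    (periodMatrix a b q).map (frob a p) = periodMatrix a b (q * p) := by
  ext1 k i
  rw [Matrix.map_apply, periodMatrix_apply, periodMatrix_apply, ← frob_ctFam, frobFam_basicForm hq]

theorem truncMatrix_map_frob (hq : q ≠ 0) (m : ℕ) :
    (truncMatrix a b q m).map (frob a p) = truncMatrix a b (q * p) m := by
  ext1 k i
  rw [Matrix.map_apply, truncMatrix_apply, truncMatrix_apply, ← frob_ctFam, map_mul,
    frobFam_basicForm hq, map_sub, map_pow, map_sub, map_one, frobFam_powSum]

end Frobenius

/-! ### Derivations -/

variable (a) in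
/-- The exponent of `v_s`. -/
def coordHom (i s : Fin N) : expCone a i →+ ℤ where
  toFun l := (l : Fin N → ℤ) s
  map_zero' := rfl
  map_add' _ _ := rfl

/-- The derivation `v_s ∂/∂v_s` on families of expansions. It is applied to quotients of forms of
the same degree in the `v_r x^(a r)`, so the normalization of the expansions is harmless. -/
def derFam (s : Fin N) (w : Expansions a b) : Expansions a b :=
  fun i => FormalSeries.der (coordHom a (b i) s) (w i)

theorem eulerDer_ctFam (s : Fin N) (w : Expansions a b) (i : J) :
    eulerDer a s (ctFam w i) = ctFam (derFam s w) i := rfl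

theorem derFam_ratio (s r : Fin N) (i : J) : derFam s (ratio a b r) i =
    (((if r = s then 1 else 0) - (if b i = s then 1 else 0) : ℤ) : Expansion a (b i)) *
      ratio a b r i := by
  rw [derFam, ratio, FormalSeries.der_single]
  congr 2
  simp [coordHom, coe_ratioExp, e, Pi.single_apply, eq_comm]

theorem derFam_powSum_one (s : Fin N) (i : J) : derFam s (powSum a b 1) i =
    ratio a b s i - ((if b i = s then 1 else 0 : ℤ) : Expansion a (b i)) * powSum a b 1 i := by
  have h : derFam s (powSum a b 1) i = ∑ r, derFam s (ratio a b r) i := by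
    simp [derFam, powSum]
  rw [h]
  simp only [derFam_ratio, Int.cast_sub, sub_mul, Finset.sum_sub_distrib, powSum, pow_one,
    Finset.sum_apply, Finset.mul_sum]
  simp

theorem derFam_basicForm_one (s : Fin N) (k : J) : derFam s (basicForm a b 1 k) =
    (if b k = s then 1 else 0 : ℤ) • basicForm a b 1 k -
      ratio a b (b k) * ratio a b s * powSumInv a b 1 ^ 2 := by
  ext1 i
  have hu : powSumInv a b 1 i * powSum a b 1 i = 1 := by
    have := congrFun (powSum_mul_inv (a := a) (b := b) one_ne_zero) i
    rwa [mul_comm] at this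
  have h1 : derFam s (powSumInv a b 1) i = -powSumInv a b 1 i ^ 2 * derFam s (powSum a b 1) i :=
    Derivation.leibniz_of_mul_eq_one _ hu
  have h2 : derFam s (basicForm a b 1 k) i = ratio a b (b k) i * derFam s (powSumInv a b 1) i +
      powSumInv a b 1 i * derFam s (ratio a b (b k)) i := by
    simp only [derFam, basicForm, pow_one, Pi.mul_apply]
    exact Derivation.leibniz _ _ _
  rw [h2, h1, derFam_powSum_one, derFam_ratio]
  simp only [basicForm, pow_one, Pi.sub_apply, Pi.mul_apply, Pi.pow_apply,
    Pi.intCast_apply, zsmul_eq_mul, Int.cast_sub]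
  linear_combination (ratio a b (b k) i * powSumInv a b 1 i *
    ((if b i = s then 1 else 0 : ℤ) : Expansion a (b i))) * hu

/-! ### Congruences for the truncated constant terms -/

variable [Fintype J] [DecidableEq J]

theorem isUnit_truncMatrix (hb : Function.Injective b) (hq : q ≠ 0) {m : ℕ} (hm : m ≠ 0) :
    IsUnit (truncMatrix a b q m) := by
  refine matrix_isUnit_of_coeff_zero fun k i => ?_
  rw [truncMatrix_apply, coeff_zero_ctFam, map_mul, constCoeffAt_basicForm hb hq, map_sub, map_pow,
    map_sub, constCoeffAt_powSum i hq, map_one, sub_self, zero_pow hm, sub_zero, one_mul]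

theorem ctFam_mul_proj (w T : Expansions a b) (i : J) : ctFam (T * proj q w) i =
    ctFam (T * w) i -
      ∑ k, (ctFam w ᵥ* (periodMatrix a b q)⁻¹) k * ctFam (T * basicForm a b q k) i := by
  rw [proj_apply, mul_sub, map_sub, Pi.sub_apply, Finset.mul_sum, map_sum, Finset.sum_apply]
  congr 1
  refine Finset.sum_congr rfl fun k _ => ?_
  rw [mul_left_comm, ctFam_constFam_mul, Pi.smul_apply, smul_eq_mul]

/-- The Cartier operator relates the truncated constant terms for `f` and for its Frobenius
transform through the same matrix as the full constant terms. -/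
theorem truncMatrix_congr [hp : Fact p.Prime] (hb : Function.Injective b) (hsat : Saturated a b)
    (hq : q ≠ 0) {m : ℕ} (hm : p ^ s ∣ m) :
    MatCongr (p ^ (s + 1))
      (periodMatrix a b q * (periodMatrix a b (q * p))⁻¹ * truncMatrix a b (q * p) m)
      (truncMatrix a b q (p * m)) := by
  intro k i
  have hq' : q * p ≠ 0 := mul_ne_zero hq hp.out.ne_zero
  set T := 1 - (1 - powSum a b (q * p)) ^ m with hT
  have hTc : cartier (q * p) T = T :=
    sub_mem (one_mem _) (pow_mem (sub_mem (one_mem _) (powSum_mem_cartierFixed (q * p))) m)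
  obtain ⟨w, hw, hww⟩ := exists_smul_eq_cartier hp.out.ne_zero
    (proj_cartier_basicForm_mem hb hsat hq (reduces hb hsat s _ hq') k)
  have h1 := ctFam_mul_proj (q := q * p) (cartier (q * p) (basicForm a b q k)) T i
  rw [← ctFam_cartier (q * p), cartier_mul hTc, hww, ← cartier_mul hTc, ctFam_cartier,
    ctFam_cartier, natCast_zsmul, mul_smul_comm, map_nsmul, Pi.smul_apply, nsmul_eq_mul] at h1
  have h2 : ((p ^ (s + 1) : ℕ) : ConeSeries a) ∣ (p : ConeSeries a) * ctFam (T * w) i := by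
    rw [pow_succ', Nat.cast_mul]
    exact mul_dvd_mul_left _ (dvd_ctFam_truncated_mul hm hw i)
  have h3 : ((p ^ (s + 1) : ℕ) : ConeSeries a) ∣
      ctFam (T * basicForm a b q k) i - truncMatrix a b q (p * m) k i := by
    rw [truncMatrix_apply, ← Pi.sub_apply, ← map_sub, ← sub_mul]
    refine dvd_ctFam (dvd_mul_of_dvd_left ?_ _) i
    rw [hT, sub_sub_sub_cancel_left]
    exact pow_dvd_frobenius_defect q hm
  have h4 : (periodMatrix a b q * (periodMatrix a b (q * p))⁻¹ * truncMatrix a b (q * p) m) k i =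
      ∑ k', (ctFam (basicForm a b q k) ᵥ* (periodMatrix a b (q * p))⁻¹) k' *
        ctFam (T * basicForm a b (q * p) k') i := by
    rw [Matrix.mul_apply]
    refine Finset.sum_congr rfl fun k' _ => ?_
    rw [Matrix.mul_apply_eq_vecMul, periodMatrix_apply, truncMatrix_apply]
  rw [h4]
  have h5 := dvd_sub h3 h2
  rw [h1] at h5
  convert h5 using 1
  ring

theorem proj_derFam_basicForm_mem [hp : Fact p.Prime] (hb : Function.Injective b)
    (hsat : Saturated a b) (r : Fin N) (k : J) (s : ℕ) :
    proj 1 (derFam r (basicForm a b 1 k)) ∈ derivLike a b p 0 s 1 := by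
  have h := reduces (p := p) hb hsat s 1 one_ne_zero 2 (Pi.single (b k) 1 + Pi.single r 1)
    (by omega) (by simp [Finset.sum_add_distrib]) (by simp) ⟨k, by simp⟩
  simp only [Nat.sub_self, pow_zero, one_smul, Pi.add_apply, pow_add, Finset.prod_mul_distrib,
    prod_ratio_single, pow_one] at h
  rw [derFam_basicForm_one, map_sub, map_zsmul, proj_basicForm hb one_ne_zero, smul_zero, zero_sub,
    neg_mem_iff]
  exact h

/-- The derivatives of the basic forms have the same coordinates for the truncated constant terms as
for the full ones. -/
theorem truncMatrix_der_congr [hp : Fact p.Prime] (hb : Function.Injective b)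
    (hsat : Saturated a b) (r : Fin N) {m : ℕ} (hm : p ^ s ∣ m) :
    MatCongr (p ^ s)
      ((periodMatrix a b 1).map (eulerDer a r) * (periodMatrix a b 1)⁻¹ * truncMatrix a b 1 m)
      ((truncMatrix a b 1 m).map (eulerDer a r)) := by
  intro k i
  set g := 1 - powSum a b 1 with hg
  set T := 1 - g ^ m with hT
  set B := basicForm a b 1 k with hB
  have h1 := dvd_ctFam_truncated_mul hm (proj_derFam_basicForm_mem (p := p) hb hsat r k s) i
  rw [← hg, ← hT, ctFam_mul_proj] at h1
  have h2 : ((periodMatrix a b 1).map (eulerDer a r) * (periodMatrix a b 1)⁻¹ *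
      truncMatrix a b 1 m) k i =
        ∑ k', (ctFam (derFam r B) ᵥ* (periodMatrix a b 1)⁻¹) k' *
          ctFam (T * basicForm a b 1 k') i := by
    rw [Matrix.mul_apply]
    refine Finset.sum_congr rfl fun k' _ => ?_
    rw [Matrix.mul_apply_eq_vecMul, truncMatrix_apply]
    rfl
  have h3 : ((p ^ s : ℕ) : ConeSeries a) ∣
      ((truncMatrix a b 1 m).map (eulerDer a r)) k i - ctFam (T * derFam r B) i := by
    rw [Matrix.map_apply, truncMatrix_apply, eulerDer_ctFam, ← Pi.sub_apply, ← map_sub]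
    refine dvd_ctFam ?_ i
    obtain ⟨m', rfl⟩ := hm
    -- The derivative of `g ^ m` is divisible by `m`.
    refine ⟨-(m' * g ^ (p ^ s * m' - 1) * derFam r g * B), ?_⟩
    ext1 i
    have e1 : derFam r (T * B) i = T i * derFam r B i + B i * derFam r T i :=
      Derivation.leibniz _ _ _
    have e2 : derFam r T i =
        -(((p ^ s * m' : ℕ) : Expansion a (b i)) * g i ^ (p ^ s * m' - 1) * derFam r g i) := by
      simp only [derFam, hT, Pi.sub_apply, Pi.one_apply, Pi.pow_apply, map_sub,
        Derivation.map_one_eq_zero, Derivation.leibniz_pow, zero_sub, nsmul_eq_mul, smul_eq_mul,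
        mul_assoc]
    rw [Pi.sub_apply, e1, e2]
    simp only [Pi.mul_apply, Pi.neg_apply, Pi.pow_apply, Pi.natCast_apply]
    push_cast
    ring
  rw [h2]
  have h4 := (dvd_add h1 h3).neg_right
  convert h4 using 1
  ring

end

section

variable {N n : ℕ} {a : Fin N ↪ (Fin n → ℤ)} {J : Type} {b : J → Fin N}

/-! ### Comparison with the periods and the truncated forms -/

theorem one_sub_powSum_one (i : J) :
    (1 - powSum a b 1) i = -∑ r ∈ Finset.univ.erase (b i), ratio a b r i := by
  have h : ratio a b (b i) i = 1 := by
    rw [ratio, (ratioExp_eq_zero_iff _ _).mpr rfl, FormalSeries.single_zero]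
  rw [Pi.sub_apply, powSum, Finset.sum_apply, ← Finset.sum_erase_add _ _ (Finset.mem_univ (b i))]
  simp only [pow_one, h, Pi.one_apply]
  ring

/-- The terms of the geometric series for `1 / f` are those of the expansion of `x ^ (a j) / f`. -/
theorem coeff_ratio_mul_pow (i : J) (j : Fin N) (k : ℕ) (l : latticeCone a) :
    (ctFam (ratio a b j * (1 - powSum a b 1) ^ k) i).coeff l =
      constTerm (expansionTerm a (b i) (a j) k) (l - e j) := by
  classical
  rw [ctFam_apply, ct_coeff, constTerm_expansionTerm, Pi.mul_apply, Pi.pow_apply,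
    one_sub_powSum_one, neg_pow, Finset.sum_pow_eq_sum_piAntidiag, Finset.mul_sum, Finset.mul_sum,
    FormalSeries.coeff_sum]
  refine Finset.sum_congr rfl fun κ _ => ?_
  have h1 : ratio a b j i * ((-1) ^ k * ((Nat.multinomial (Finset.univ.erase (b i)) κ : ℕ) *
      ∏ r ∈ Finset.univ.erase (b i), ratio a b r i ^ κ r)) =
      (((-1) ^ k * (Nat.multinomial (Finset.univ.erase (b i)) κ : ℤ) : ℤ) :
        Expansion a (b i)) * FormalSeries.single (ratioExp a (b i) j +
          ∑ r ∈ Finset.univ.erase (b i), κ r • ratioExp a (b i) r) := by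
    rw [← FormalSeries.single_mul_single, ← FormalSeries.prod_single]
    simp only [ratio, FormalSeries.single_pow]
    push_cast
    ring
  rw [h1, FormalSeries.coeff_intCast_mul, FormalSeries.coeff_single, mul_ite, mul_one, mul_zero]
  have hcoe : ((ratioExp a (b i) j + ∑ r ∈ Finset.univ.erase (b i), κ r • ratioExp a (b i) r :
      expCone a (b i)) : Fin N → ℤ) =
        e j + (-e (b i) + ∑ r ∈ Finset.univ.erase (b i), (κ r : ℤ) • (e r - e (b i))) := by
    simp only [AddSubmonoid.coe_add, AddSubmonoid.coe_finsetSum, AddSubmonoidClass.coe_nsmul,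
      coe_ratioExp, natCast_zsmul]
    abel
  have hiff : inclCone (b i) l = ratioExp a (b i) j +
      ∑ r ∈ Finset.univ.erase (b i), κ r • ratioExp a (b i) r ↔
        -e (b i) + ∑ r ∈ Finset.univ.erase (b i), (κ r : ℤ) • (e r - e (b i)) = l - e j ∧
          a j - a (b i) + ∑ r ∈ Finset.univ.erase (b i), (κ r : ℤ) • (a r - a (b i)) = 0 := by
    rw [Subtype.ext_iff, hcoe, coe_inclCone, eq_sub_iff_add_eq', eq_comm, iff_self_and]
    intro h
    have h2 := congrArg (deg a) h
    rw [(sum_zero_of_mem_latticeCone l.2).2] at h2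
    simp only [map_add, map_neg, map_sum, map_zsmul, map_sub, deg_e] at h2
    rw [← h2]
    abel
  simp only [hiff]

theorem ctFam_basicForm_one (k i : J) :
    ctFam (basicForm a b 1 k) i = PsiEntry a (b k) (b i) := by
  ext l
  set g := 1 - powSum a b 1 with hg
  set K := PosWeight.wt l + 1 with hK
  have hg1 : ∀ i, constCoeffAt i g = 0 := fun i => by
    rw [hg, map_sub, map_one, constCoeffAt_powSum i one_ne_zero, sub_self]
  have hhigh : ∀ w ∈ highFam a b K, (ctFam w i).coeff l = 0 := fun w hw =>
    mem_highFam.mp hw i _ (by rw [wt_inclCone]; omega)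
  have h1 : basicForm a b 1 k - ∑ k' ∈ Finset.range K, ratio a b (b k) * g ^ k' ∈
      highFam a b K := by
    have h2 : basicForm a b 1 k - ∑ k' ∈ Finset.range K, ratio a b (b k) * g ^ k' =
        ratio a b (b k) * powSumInv a b 1 * g ^ K := by
      have h3 := mul_neg_geom_sum g K
      have h4 := powSum_mul_inv (a := a) (b := b) one_ne_zero
      rw [hg, sub_sub_cancel, ← hg] at h3
      rw [← Finset.mul_sum, basicForm, pow_one]
      linear_combination (-ratio a b (b k) * powSumInv a b 1) * h3 +
        (ratio a b (b k) * ∑ k' ∈ Finset.range K, g ^ k') * h4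
    rw [h2]
    exact Ideal.mul_mem_left _ _ (pow_mem_highFam hg1 K)
  have h5 := hhigh _ h1
  have hsum : (ctFam (basicForm a b 1 k) i).coeff l =
      ∑ k' ∈ Finset.range K, (ctFam (ratio a b (b k) * g ^ k') i).coeff l := by
    rw [ctFam_apply, ct_coeff, Pi.sub_apply, FormalSeries.coeff_sub, sub_eq_zero,
      Finset.sum_apply, FormalSeries.coeff_sum] at h5
    exact h5
  rw [hsum]
  simp only [hg, coeff_ratio_mul_pow, PsiEntry, period]
  refine (finsum_eq_sum_of_support_subset _ fun k' hk' => ?_).symm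
  rw [Function.mem_support, ← coeff_ratio_mul_pow] at hk'
  by_contra hn
  have hle : K ≤ k' := by simpa using hn
  refine hk' (hhigh _ (Ideal.mul_mem_left _ _ ?_))
  rw [← Nat.add_sub_cancel' hle, pow_add]
  exact Ideal.mul_mem_right _ _ (pow_mem_highFam hg1 K)

theorem truncMatrix_one_apply (m : ℕ) (k i : J) :
    truncMatrix a b 1 m k i = psiEntry a m (b k) (b i) := by
  ext l
  set g := 1 - powSum a b 1 with hg
  have h1 : (1 - g ^ m) * basicForm a b 1 k =
      ∑ k' ∈ Finset.range m, ratio a b (b k) * g ^ k' := by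
    have h3 := mul_neg_geom_sum g m
    have h4 := powSum_mul_inv (a := a) (b := b) one_ne_zero
    rw [hg, sub_sub_cancel, ← hg] at h3
    rw [← Finset.mul_sum, basicForm, pow_one]
    linear_combination (-ratio a b (b k) * powSumInv a b 1) * h3 +
      (ratio a b (b k) * ∑ k' ∈ Finset.range m, g ^ k') * h4
  rw [truncMatrix_apply, ← hg, h1]
  simp only [psiEntry, truncatedForm_eq_sum]
  rw [constTerm, AddMonoidAlgebra.coeff_sum, Finsupp.finsetSum_apply, ctFam_apply, ct_coeff,
    Finset.sum_apply, FormalSeries.coeff_sum]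
  exact Finset.sum_congr rfl fun k' _ => coeff_ratio_mul_pow i (b k) k' l

/-! ### Lattice points of open subsets of the Newton polytope -/

/-- A weighted mean of the exponents lies in the open set `μ` as soon as one of the exponents
involved does: a face containing the mean contains all exponents of positive weight. -/
theorem mem_of_mean {μ : Set (Fin n → ℝ)} (hμ : IsOpenSubset (newtonPolytope a) μ)
    {w : Fin N → ℝ} (hw : ∀ r, 0 ≤ w r) (hw1 : ∑ r, w r = 1) {k : Fin N} (hk : w k ≠ 0)
    (hkμ : toReal (a k) ∈ μ) : ∑ r, w r • toReal (a r) ∈ μ := by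
  obtain ⟨hsub, F, hF, hdiff⟩ := hμ
  set x := ∑ r, w r • toReal (a r) with hx
  have hvert : ∀ r, toReal (a r) ∈ newtonPolytope a := fun r =>
    subset_convexHull ℝ _ ⟨r, rfl⟩
  have hxΔ : x ∈ newtonPolytope a :=
    (convex_convexHull ℝ _).sum_mem (fun r _ => hw r) hw1 fun r _ => hvert r
  by_contra hxμ
  obtain ⟨A, hA, hxA⟩ : x ∈ ⋃₀ F := hdiff ▸ ⟨hxΔ, hxμ⟩
  obtain ⟨l, hl⟩ := hF A hA ⟨x, hxA⟩
  have hxmax : ∀ y ∈ newtonPolytope a, l y ≤ l x := by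
    rw [hl] at hxA
    exact hxA.2
  have hsum : ∑ r, w r * (l x - l (toReal (a r))) = 0 := by
    simp only [mul_sub, Finset.sum_sub_distrib, ← Finset.sum_mul, hw1, one_mul]
    rw [hx, map_sum, sub_eq_zero]
    simp
  have h0 := (Finset.sum_eq_zero_iff_of_nonneg fun r _ =>
    mul_nonneg (hw r) (sub_nonneg.mpr (hxmax _ (hvert r)))).mp hsum k (Finset.mem_univ k)
  have heq : l x = l (toReal (a k)) :=
    sub_eq_zero.mp ((mul_eq_zero.mp h0).resolve_left hk)
  have hkA : toReal (a k) ∈ A := by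
    rw [hl]
    exact ⟨hvert k, fun y hy => heq ▸ hxmax y hy⟩
  have : toReal (a k) ∈ newtonPolytope a \ μ := hdiff ▸ ⟨A, hA, hkA⟩
  exact this.2 hkμ

theorem saturated_of_isOpenSubset {μ : Set (Fin n → ℝ)}
    (hμ : IsOpenSubset (newtonPolytope a) μ) (hpos : 1 ≤ (integralPoints μ).ncard)
    (hcard : {j | toReal (a j) ∈ μ}.ncard = (integralPoints μ).ncard) :
    Saturated a (Subtype.val : {j // toReal (a j) ∈ μ} → Fin N) := by
  rintro q hq κ hκ hd ⟨⟨k, hkμ⟩, hk⟩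
  choose u hu using hd
  have hq' : (q : ℝ) ≠ 0 := by exact_mod_cast hq
  have hmem : toReal u ∈ μ := by
    have h1 : toReal u = ∑ r, ((κ r : ℝ) / q) • toReal (a r) := by
      funext d
      have h2 : ((deg a (fun r => (κ r : ℤ)) d : ℤ) : ℝ) = q * u d := by exact_mod_cast hu d
      simp only [deg, AddMonoidHom.coe_mk, ZeroHom.coe_mk, Finset.sum_apply, Pi.smul_apply,
        smul_eq_mul, Int.cast_sum, Int.cast_mul, Int.cast_natCast] at h2
      simp only [toReal, Finset.sum_apply, Pi.smul_apply, smul_eq_mul, div_mul_eq_mul_div,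
        ← Finset.sum_div, h2]
      field_simp
    rw [h1]
    refine mem_of_mean hμ (fun r => by positivity) ?_ (k := k) ?_ hkμ
    · rw [← Finset.sum_div, div_eq_one_iff_eq hq']
      exact_mod_cast hκ
    · exact div_ne_zero (by exact_mod_cast hk) hq'
  have hfin : (integralPoints μ).Finite := Set.finite_of_ncard_pos hpos
  have himage : a '' {j | toReal (a j) ∈ μ} = integralPoints μ := by
    refine Set.eq_of_subset_of_ncard_le ?_ ?_ hfin
    · rintro _ ⟨j, hj, rfl⟩
      exact hj
    · rw [Set.ncard_image_of_injective _ a.injective, hcard]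
  obtain ⟨j, hj, hju⟩ : u ∈ a '' {j | toReal (a j) ∈ μ} := himage ▸ hmem
  refine ⟨⟨j, hj⟩, funext fun d => ?_⟩
  rw [hu, hju]
  simp

theorem matCongr_mul_inv {ι R : Type} [CommRing R] [Fintype ι] [DecidableEq ι] {q : ℕ}
    {L T A : Matrix ι ι R} (h : MatCongr q (L * T) A) (hT : IsUnit T) :
    MatCongr q L (A * T⁻¹) := by
  intro j i
  have h1 : L - A * T⁻¹ = (L * T - A) * T⁻¹ := by
    rw [sub_mul, Matrix.mul_nonsing_inv_cancel_right _ _ ((Matrix.isUnit_iff_isUnit_det T).mp hT)]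
  rw [← Matrix.sub_apply, h1, Matrix.mul_apply]
  exact Finset.dvd_sum fun k _ => dvd_mul_of_dvd_left (h j k) _

theorem periodMatrix_one (μ : Set (Fin n → ℝ)) :
    periodMatrix a (Subtype.val : {j // toReal (a j) ∈ μ} → Fin N) 1 = PsiMatrix a μ := by
  ext1 k i
  exact ctFam_basicForm_one k i

theorem truncMatrix_one (μ : Set (Fin n → ℝ)) (m : ℕ) :
    truncMatrix a (Subtype.val : {j // toReal (a j) ∈ μ} → Fin N) 1 m = psiMatrix a μ m := by
  ext1 k i
  exact truncMatrix_one_apply m k i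

end

end AHypergeometric

end

open AHypergeometric
theorem theorem5 {N n : ℕ} (a : Fin N ↪ (Fin n → ℤ)) (p : ℕ) [Fact p.Prime]
    (μ : Set (Fin n → ℝ)) [DecidablePred fun j => toReal (a j) ∈ μ]
    (hμ : IsOpenSubset (newtonPolytope a) μ)
    (hpos : 1 ≤ (integralPoints μ).ncard)
    (hcard : {j | toReal (a j) ∈ μ}.ncard = (integralPoints μ).ncard) :
    IsUnit (PsiMatrix a μ) ∧
    (∀ m : ℕ, 1 ≤ m → IsUnit (psiMatrix a μ m)) ∧
    (∀ m : ℕ, 1 ≤ m →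
      MatCongr (p ^ padicValNat p m)
        (PsiMatrix a μ * ((PsiMatrix a μ).map (frob a p))⁻¹)
        (psiMatrix a μ m * ((psiMatrix a μ (m / p)).map (frob a p))⁻¹)) ∧
    (∀ (s : Fin N) (m : ℕ), 1 ≤ m →
      MatCongr (p ^ padicValNat p m)
        ((PsiMatrix a μ).map (eulerDer a s) * (PsiMatrix a μ)⁻¹)
        ((psiMatrix a μ m).map (eulerDer a s) * (psiMatrix a μ m)⁻¹)) := by
  have hp : p.Prime := Fact.out
  have hb : Function.Injective (Subtype.val : {j // toReal (a j) ∈ μ} → Fin N) :=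
    Subtype.val_injective
  have hsat := saturated_of_isOpenSubset hμ hpos hcard
  rw [← periodMatrix_one]
  simp only [← truncMatrix_one]
  refine ⟨isUnit_periodMatrix hb one_ne_zero,
    fun m hm => isUnit_truncMatrix hb one_ne_zero (by omega), fun m hm => ?_, fun r m hm => ?_⟩
  · obtain hs | ⟨s, hs⟩ : padicValNat p m = 0 ∨ ∃ s, padicValNat p m = s + 1 := by
      cases padicValNat p m with
      | zero => exact Or.inl rfl
      | succ s => exact Or.inr ⟨s, rfl⟩
    · intro j i
      rw [hs, pow_zero, Nat.cast_one]
      exact one_dvd _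
    · have hdvd : p ^ (s + 1) ∣ m := hs ▸ pow_padicValNat_dvd
      obtain ⟨m, rfl⟩ := dvd_trans (dvd_pow_self p s.succ_ne_zero) hdvd
      rw [pow_succ'] at hdvd
      rw [hs, Nat.mul_div_cancel_left _ hp.pos, periodMatrix_map_frob one_ne_zero,
        truncMatrix_map_frob one_ne_zero]
      refine matCongr_mul_inv
        (truncMatrix_congr hb hsat one_ne_zero (Nat.dvd_of_mul_dvd_mul_left hp.pos hdvd))
        (isUnit_truncMatrix hb (by simp [hp.ne_zero]) ?_)
      rintro rfl
      simp at hm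
  · exact matCongr_mul_inv (truncMatrix_der_congr hb hsat r pow_padicValNat_dvd)
      (isUnit_truncMatrix hb one_ne_zero (by omega))
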